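/- Definitions. (1) $\Delta$ is the category whose objects are all finite ordinals $n=\{0,\dots,n-1\}$, $n\ge 0$, and whose arrows $n\to m$ are all order-preserving functions. $\Delta_{\mathrm{last}}$ is the subcategory of $\Delta$ whose objects are the ordinals $n\geq 1$ and whose arrows $n\to m$ are the order-preserving functions that map $n-1$ to $m-1$. (2) The free adjunction $\langle\mathcal A,\mathcal B,F,G,\varphi^a,\gamma^c\rangle$ generated by $(\emptyset,\{\emptyset\})$, i.e. $(0,1)$: the objects of $\mathcal B$ are the words $(GF)^n\emptyset$, $n\ge 0$, and those of $\mathcal A$ are the words $F(GF)^n\emptyset$. Arrow terms are generated from identities by composition (in $\mathcal A$ and in $\mathcal B$) and by the following operations: $g\colon b_1\to b_2$ gives $Fg\colon Fb_1\to Fb_2$; $f\colon a_1\to a_2$ gives $Gf\colon Ga_1\to Ga_2$; $f\colon a_1\to a_2$ gives $\varphi^a f\colon FGa_1\to a_2$; $g\colon b_1\to b_2$ gives $\gamma^c g\colon b_1\to GFb_2$. Arrows are the equivalence classes of terms under the congruence generated by the category axioms, the functor axioms for $F$ and $G$, and $$f_2\circ\varphi^a f_1=\varphi^a(f_2\circ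 f_1),\quad \gamma^c g_2\circ g_1=\gamma^c(g_2\circ g_1),\quad \varphi^a f_2\circ FGf_1=\varphi^a(f_2\circ f_1),\quad GFg_2\circ\gamma^c g_1=\gamma^c(g_2\circ g_1),$$ $$\varphi^a f\circ F\gamma^c g=f\circ Fg,\qquad G\varphi^a f\circ\gamma^c g=Gf\circ g .$$ (3) A segment is an interval $[a,b]$ in $\mathbb Z\setminus\{0\}$ with $a<b$; it is a cup if $0<a$, a cap if $b<0$, and transversal if $a<0<b$. A frieze is a set of segments such that any two distinct ones are disjoint or one of them encloses the other ($[a,b]$ encloses $[c,d]$ when $a<c$ and $d<b$), every nonzero integer is an end point of some segment of the set, every cup is of the form $[2k+2,2k+3]$ and every cap is of the form $[-(2k+2),-(2k+1)]$, $k\in\mathbb N$. It is of type $(n,m)$ if it contains $[-(m+k),n+k]$ for all $k\ge1$. The unit frieze is $\{[-(k+1),k+1]\mid k\in\mathbb N\}$. The composition $D_2\circ D_1$ is obtained by drawing $D_1$ above $D_2$, identifying the point $-k$ of $D_1$ with the point $k$ of $D_2$, and taking the segments whose end points, on the outer lines, are connected in the resulting diagram. $\mathcal D_{\mathcal B}$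 (resp. $\mathcal D_{\mathcal A}$) has as objects the even (resp. odd) natural numbers and as arrows $n\to m$ the friezes of type $(n,m)$. Theorem. (i) There is an isomorphism of categories $T\colon\mathcal B\to\Delta$ with $T((GF)^n\emptyset)=n$, and an isomorphism of categories $T'\colon\mathcal A\to\Delta_{\mathrm{last}}$ such that $T'$ followed by the inclusion $\Delta_{\mathrm{last}}\hookrightarrow\Delta$ equals $T\circ G$. (ii) The arrows of $\mathcal B$ of the form $Gf$ form a subcategory of $\mathcal B$ with objects $(GF)^n\emptyset$, $n\ge1$, and $G$ is an isomorphism of $\mathcal A$ onto this subcategory. In particular $\mathcal A$ is isomorphic to a subcategory of $\mathcal B$. (iii) With the unit frieze and the composition of friezes, the friezes of type $(n,m)$, for $n,m\in\mathbb N$, are the arrows of a category with the natural numbers as objects; so $\mathcal D_{\mathcal A}$ and $\mathcal D_{\mathcal B}$ are categories. There is an isomorphism $S\colon\mathcal D_{\mathcal B}\to\Delta$ with $S(2n)=n$ such that for every frieze $D$ of type $(2n,2m)$ and $i<n$ there are natural numbers $k_2\le i\le k_2+k_3$ for which the transversal segments $[-(2k_1+1),2k_2+1]$ and $[-(2k_1+2),2k_2+2k_3+2]$,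 where $k_1=S(D)(i)$, are in $D$. The functor $J\colon\mathcal D_{\mathcal A}\to\mathcal D_{\mathcal B}$ that sends $n$ to $n+1$ and each frieze to itself is an isomorphism onto the subcategory of $\mathcal D_{\mathcal B}$ with positive objects whose arrows $n\to m$ are the friezes that contain $[-m,n]$; and there is an isomorphism $S'\colon\mathcal D_{\mathcal A}\to\Delta_{\mathrm{last}}$ such that $S'$ followed by the inclusion into $\Delta$ equals $S\circ J$. -/

import Mathlib

open CategoryTheory

/-! ## Subcategories (neither full nor wide in general) -/

namespace FreeAdj

/-- A subcategory of `C`: a set of objects and a set of arrows between them, containing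
identities and closed under composition. -/
structure Subcat (C : Type) [Category.{0} C] where
  obj : C → Prop
  hom : MorphismProperty C
  src_mem : ∀ {X Y : C} {f : X ⟶ Y}, hom f → obj X
  tgt_mem : ∀ {X Y : C} {f : X ⟶ Y}, hom f → obj Y
  id_mem : ∀ {X : C}, obj X → hom (𝟙 X)
  comp_mem : ∀ {X Y Z : C} {f : X ⟶ Y} {g : Y ⟶ Z}, hom f → hom g → hom (f ≫ g)

/-- The objects of a subcategory. -/
structure Subcat.Cat {C : Type} [Category.{0} C] (S : Subcat C) where
  val : C
  mem : S.obj val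

instance Subcat.category {C : Type} [Category.{0} C] (S : Subcat C) : Category.{0} S.Cat where
  Hom X Y := {f : X.val ⟶ Y.val // S.hom f}
  id X := ⟨𝟙 X.val, S.id_mem X.mem⟩
  comp f g := ⟨f.1 ≫ g.1, S.comp_mem f.2 g.2⟩
  id_comp f := Subtype.ext (Category.id_comp f.1)
  comp_id f := Subtype.ext (Category.comp_id f.1)
  assoc f g h := Subtype.ext (Category.assoc f.1 g.1 h.1)

/-- The inclusion functor of a subcategory. -/
def Subcat.incl {C : Type} [Category.{0} C] (S : Subcat C) : S.Cat ⥤ C where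
  obj X := X.val
  map f := f.1

/-! ## The simplicial category -/

/-- Objects of the simplicial category: the finite ordinals `n = {0, …, n - 1}`, including `0`. -/
structure Delta where
  n : ℕ

instance Delta.category : Category.{0} Delta where
  Hom X Y := Fin X.n →o Fin Y.n
  id _ := OrderHom.id
  comp f g := g.comp f

/-- The order-preserving function underlying an arrow of `Delta`. -/
def Delta.fn {X Y : Delta} (f : X ⟶ Y) : Fin X.n → Fin Y.n :=
  fun i => (show Fin X.n →o Fin Y.n from f) i

/-- `f : n → m` (with `n, m ≥ 1`) maps `n - 1` to `m - 1`. -/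
def Delta.PreservesLast {X Y : Delta} (f : X ⟶ Y) : Prop :=
  ∃ (hX : 0 < X.n) (hY : 0 < Y.n),
    Delta.fn f ⟨X.n - 1, Nat.sub_lt hX one_pos⟩ = ⟨Y.n - 1, Nat.sub_lt hY one_pos⟩

/-- The subcategory of `Delta` of the nonempty ordinals and the last-element-preserving
order-preserving functions. -/
def deltaLast : Subcat Delta where
  obj X := 0 < X.n
  hom _ _ f := Delta.PreservesLast f
  src_mem h := h.1
  tgt_mem h := h.2.1
  id_mem h := ⟨h, h, rfl⟩
  comp_mem := by
    rintro X Y Z f g ⟨hX, hY, hf⟩ ⟨_, hZ, hg⟩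
    refine ⟨hX, hZ, ?_⟩
    change Delta.fn g (Delta.fn f _) = _
    rw [hf, hg]

/-! ## The free adjunction generated by `(∅, {∅})` -/

/-- `⟨n⟩` is the word `(GF)ⁿ∅`. -/
structure BObj where
  n : ℕ

/-- `⟨b⟩` is the word `F b`, i.e. `b` with `F` prefixed. -/
structure AObj where
  base : BObj

/-- The word `F b`. -/
abbrev FObj (b : BObj) : AObj := ⟨b⟩

/-- The word `G a`; for `a = F(GF)ⁿ∅` this is `(GF)ⁿ⁺¹∅`. -/
abbrev GObj (a : AObj) : BObj := ⟨a.base.n + 1⟩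

mutual
/-- Arrow terms of the category `A`. -/
inductive ATerm : AObj → AObj → Type
  | id (a : AObj) : ATerm a a
  | comp {a₁ a₂ a₃ : AObj} (f₂ : ATerm a₂ a₃) (f₁ : ATerm a₁ a₂) : ATerm a₁ a₃
  | F {b₁ b₂ : BObj} (g : BTerm b₁ b₂) : ATerm (FObj b₁) (FObj b₂)
  | phi {a₁ a₂ : AObj} (f : ATerm a₁ a₂) : ATerm (FObj (GObj a₁)) a₂
/-- Arrow terms of the category `B`. -/
inductive BTerm : BObj → BObj → Type
  | id (b : BObj) : BTerm b b
  | comp {b₁ b₂ b₃ : BObj} (g₂ : BTerm b₂ b₃) (g₁ : BTerm b₁ b₂) : BTerm b₁ b₃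
  | G {a₁ a₂ : AObj} (f : ATerm a₁ a₂) : BTerm (GObj a₁) (GObj a₂)
  | gam {b₁ b₂ : BObj} (g : BTerm b₁ b₂) : BTerm b₁ (GObj (FObj b₂))
end

mutual
/-- Equality of arrow terms of `A`: the congruence generated, together with `BEq`, by the
equations of categories, functors and adjunctions. -/
inductive AEq : {a₁ a₂ : AObj} → ATerm a₁ a₂ → ATerm a₁ a₂ → Prop
  | refl {a₁ a₂ : AObj} (f : ATerm a₁ a₂) : AEq f f
  | symm {a₁ a₂ : AObj} {f g : ATerm a₁ a₂} : AEq f g → AEq g f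
  | trans {a₁ a₂ : AObj} {f g h : ATerm a₁ a₂} : AEq f g → AEq g h → AEq f h
  | congr_comp {a₁ a₂ a₃ : AObj} {f₂ g₂ : ATerm a₂ a₃} {f₁ g₁ : ATerm a₁ a₂} :
      AEq f₂ g₂ → AEq f₁ g₁ → AEq (.comp f₂ f₁) (.comp g₂ g₁)
  | congr_F {b₁ b₂ : BObj} {g g' : BTerm b₁ b₂} : BEq g g' → AEq (.F g) (.F g')
  | congr_phi {a₁ a₂ : AObj} {f f' : ATerm a₁ a₂} : AEq f f' → AEq (.phi f) (.phi f')
  | cat_right {a₁ a₂ : AObj} (f : ATerm a₁ a₂) : AEq (.comp f (.id a₁)) f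
  | cat_left {a₁ a₂ : AObj} (f : ATerm a₁ a₂) : AEq (.comp (.id a₂) f) f
  | cat_assoc {a₁ a₂ a₃ a₄ : AObj} (h : ATerm a₃ a₄) (g : ATerm a₂ a₃) (f : ATerm a₁ a₂) :
      AEq (.comp h (.comp g f)) (.comp (.comp h g) f)
  | fun_id (b : BObj) : AEq (.F (.id b)) (.id (FObj b))
  | fun_comp {b₁ b₂ b₃ : BObj} (g₂ : BTerm b₂ b₃) (g₁ : BTerm b₁ b₂) :
      AEq (.comp (.F g₂) (.F g₁)) (.F (.comp g₂ g₁))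
  | nat₁ {a₁ a₂ a₃ : AObj} (f₂ : ATerm a₂ a₃) (f₁ : ATerm a₁ a₂) :
      AEq (.comp f₂ (.phi f₁)) (.phi (.comp f₂ f₁))
  | nat₂ {a₁ a₂ a₃ : AObj} (f₂ : ATerm a₂ a₃) (f₁ : ATerm a₁ a₂) :
      AEq (.comp (.phi f₂) (.F (.G f₁))) (.phi (.comp f₂ f₁))
  | triangle {b₁ b₂ : BObj} {a : AObj} (f : ATerm (FObj b₂) a) (g : BTerm b₁ b₂) :
      AEq (.comp (.phi f) (.F (.gam g))) (.comp f (.F g))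
/-- Equality of arrow terms of `B`. -/
inductive BEq : {b₁ b₂ : BObj} → BTerm b₁ b₂ → BTerm b₁ b₂ → Prop
  | refl {b₁ b₂ : BObj} (g : BTerm b₁ b₂) : BEq g g
  | symm {b₁ b₂ : BObj} {f g : BTerm b₁ b₂} : BEq f g → BEq g f
  | trans {b₁ b₂ : BObj} {f g h : BTerm b₁ b₂} : BEq f g → BEq g h → BEq f h
  | congr_comp {b₁ b₂ b₃ : BObj} {f₂ g₂ : BTerm b₂ b₃} {f₁ g₁ : BTerm b₁ b₂} :
      BEq f₂ g₂ → BEq f₁ g₁ → BEq (.comp f₂ f₁) (.comp g₂ g₁)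
  | congr_G {a₁ a₂ : AObj} {f f' : ATerm a₁ a₂} : AEq f f' → BEq (.G f) (.G f')
  | congr_gam {b₁ b₂ : BObj} {g g' : BTerm b₁ b₂} : BEq g g' → BEq (.gam g) (.gam g')
  | cat_right {b₁ b₂ : BObj} (g : BTerm b₁ b₂) : BEq (.comp g (.id b₁)) g
  | cat_left {b₁ b₂ : BObj} (g : BTerm b₁ b₂) : BEq (.comp (.id b₂) g) g
  | cat_assoc {b₁ b₂ b₃ b₄ : BObj} (h : BTerm b₃ b₄) (g : BTerm b₂ b₃) (f : BTerm b₁ b₂) :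
      BEq (.comp h (.comp g f)) (.comp (.comp h g) f)
  | fun_id (a : AObj) : BEq (.G (.id a)) (.id (GObj a))
  | fun_comp {a₁ a₂ a₃ : AObj} (f₂ : ATerm a₂ a₃) (f₁ : ATerm a₁ a₂) :
      BEq (.comp (.G f₂) (.G f₁)) (.G (.comp f₂ f₁))
  | nat₁ {b₁ b₂ b₃ : BObj} (g₂ : BTerm b₂ b₃) (g₁ : BTerm b₁ b₂) :
      BEq (.comp (.gam g₂) g₁) (.gam (.comp g₂ g₁))
  | nat₂ {b₁ b₂ b₃ : BObj} (g₂ : BTerm b₂ b₃) (g₁ : BTerm b₁ b₂) :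
      BEq (.comp (.G (.F g₂)) (.gam g₁)) (.gam (.comp g₂ g₁))
  | triangle {a₁ a₂ : AObj} {b : BObj} (f : ATerm a₁ a₂) (g : BTerm b (GObj a₁)) :
      BEq (.comp (.G (.phi f)) (.gam g)) (.comp (.G f) g)
end

/-- Terms of `A` modulo the equations. -/
instance aSetoid (a₁ a₂ : AObj) : Setoid (ATerm a₁ a₂) := ⟨AEq, .refl, .symm, .trans⟩

/-- Terms of `B` modulo the equations. -/
instance bSetoid (b₁ b₂ : BObj) : Setoid (BTerm b₁ b₂) := ⟨BEq, .refl, .symm, .trans⟩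

/-- The category `A` of the free adjunction; arrows are equivalence classes of arrow terms. -/
instance AObj.category : Category.{0} AObj where
  Hom a₁ a₂ := Quotient (aSetoid a₁ a₂)
  id a := ⟦.id a⟧
  comp f g := Quotient.map₂ (fun s t => ATerm.comp t s)
    (fun _ _ hs _ _ ht => AEq.congr_comp ht hs) f g
  id_comp := by rintro _ _ ⟨f⟩; exact Quotient.sound (AEq.cat_right f)
  comp_id := by rintro _ _ ⟨f⟩; exact Quotient.sound (AEq.cat_left f)
  assoc := by rintro _ _ _ _ ⟨f⟩ ⟨g⟩ ⟨h⟩; exact Quotient.sound (AEq.cat_assoc h g f)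

/-- The category `B` of the free adjunction; arrows are equivalence classes of arrow terms. -/
instance BObj.category : Category.{0} BObj where
  Hom b₁ b₂ := Quotient (bSetoid b₁ b₂)
  id b := ⟦.id b⟧
  comp f g := Quotient.map₂ (fun s t => BTerm.comp t s)
    (fun _ _ hs _ _ ht => BEq.congr_comp ht hs) f g
  id_comp := by rintro _ _ ⟨f⟩; exact Quotient.sound (BEq.cat_right f)
  comp_id := by rintro _ _ ⟨f⟩; exact Quotient.sound (BEq.cat_left f)
  assoc := by rintro _ _ _ _ ⟨f⟩ ⟨g⟩ ⟨h⟩; exact Quotient.sound (BEq.cat_assoc h g f)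

/-- The functor `F : B ⥤ A` of the free adjunction. -/
def functorF : BObj ⥤ AObj where
  obj := FObj
  map g := Quotient.map ATerm.F (fun _ _ h => AEq.congr_F h) g
  map_id b := Quotient.sound (AEq.fun_id b)
  map_comp := by rintro _ _ _ ⟨f⟩ ⟨g⟩; exact Quotient.sound (AEq.fun_comp g f).symm

/-- The functor `G : A ⥤ B` of the free adjunction. -/
def functorG : AObj ⥤ BObj where
  obj := GObj
  map f := Quotient.map BTerm.G (fun _ _ h => BEq.congr_G h) f
  map_id a := Quotient.sound (BEq.fun_id a)
  map_comp := by rintro _ _ _ ⟨f⟩ ⟨g⟩; exact Quotient.sound (BEq.fun_comp g f).symm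

/-- The adjunction `F ⊣ G`, with unit `γ_b = γᶜ 1_b` and counit `φ_a = φᵃ 1_a`. -/
def adjunction : functorF ⊣ functorG :=
  Adjunction.mkOfUnitCounit
    { unit :=
        { app := fun b => (⟦.gam (.id b)⟧ : Quotient (bSetoid _ _))
          naturality := by
            rintro b₁ b₂ ⟨g⟩
            refine Quotient.sound (s := bSetoid _ _) ?_
            exact (((BEq.nat₁ _ g).trans (.congr_gam (.cat_left g))).trans
              (.symm (.congr_gam (.cat_right g)))).trans (.symm (.nat₂ g _)) }
      counit :=
        { app := fun a => (⟦.phi (.id a)⟧ : Quotient (aSetoid _ _))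
          naturality := by
            rintro a₁ a₂ ⟨f⟩
            refine Quotient.sound (s := aSetoid _ _) ?_
            exact (((AEq.nat₂ _ f).trans (.congr_phi (.cat_left f))).trans
              (.symm (.congr_phi (.cat_right f)))).trans (.symm (.nat₁ f _)) }
      left_triangle := by
        refine NatTrans.ext (funext fun b => ?_)
        exact Quotient.sound (s := aSetoid _ _)
          ((((AEq.cat_right _).congr_comp (.refl _)).trans
            ((AEq.triangle (.id (FObj b)) (.id b)).trans (.cat_left _))).trans (.fun_id b))
      right_triangle := by
        refine NatTrans.ext (funext fun a => ?_)
        exact Quotient.sound (s := bSetoid _ _)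
          ((((BEq.cat_right _).congr_comp (.refl _)).trans
            ((BEq.triangle (.id a) (.id (GObj a))).trans (.cat_right _))).trans (.fun_id a)) }

/-- Arrows of `B` of the form `G f`, for `f` an arrow of `A`. -/
inductive IsGArrow : ∀ {X Y : BObj}, (X ⟶ Y) → Prop
  | mk {a₁ a₂ : AObj} (f : a₁ ⟶ a₂) : IsGArrow (functorG.map f)

theorem IsGArrow.pos {X Y : BObj} {f : X ⟶ Y} (h : IsGArrow f) : 1 ≤ X.n ∧ 1 ≤ Y.n := by
  cases h
  exact ⟨Nat.succ_pos _, Nat.succ_pos _⟩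

theorem IsGArrow.exists_heq {X Y : BObj} {f : X ⟶ Y} (h : IsGArrow f) (a₁ a₂ : AObj)
    (hX : X = functorG.obj a₁) (hY : Y = functorG.obj a₂) :
    ∃ f' : a₁ ⟶ a₂, HEq f (functorG.map f') := by
  cases h with
  | @mk c₁ c₂ f =>
    obtain ⟨⟨c₁⟩⟩ := c₁
    obtain ⟨⟨c₂⟩⟩ := c₂
    obtain ⟨⟨a₁⟩⟩ := a₁
    obtain ⟨⟨a₂⟩⟩ := a₂
    obtain rfl : c₁ = a₁ := Nat.succ.inj (congrArg BObj.n hX)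
    obtain rfl : c₂ = a₂ := Nat.succ.inj (congrArg BObj.n hY)
    exact ⟨f, HEq.rfl⟩

/-- The subcategory of `B` whose objects are the `(GF)ⁿ∅` with `n ≥ 1` and whose arrows are the
arrows of `B` of the form `G f`. -/
def imageG : Subcat BObj where
  obj X := 1 ≤ X.n
  hom _ _ f := IsGArrow f
  src_mem h := h.pos.1
  tgt_mem h := h.pos.2
  id_mem := by
    rintro ⟨n⟩ h
    obtain ⟨k, rfl⟩ : ∃ k, n = k + 1 := Nat.exists_eq_add_of_le' h
    exact functorG.map_id ⟨⟨k⟩⟩ ▸ IsGArrow.mk (𝟙 (⟨⟨k⟩⟩ : AObj))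
  comp_mem := by
    rintro ⟨x⟩ ⟨y⟩ ⟨z⟩ f g hf hg
    obtain ⟨x, rfl⟩ : ∃ k, x = k + 1 := Nat.exists_eq_add_of_le' hf.pos.1
    obtain ⟨y, rfl⟩ : ∃ k, y = k + 1 := Nat.exists_eq_add_of_le' hf.pos.2
    obtain ⟨z, rfl⟩ : ∃ k, z = k + 1 := Nat.exists_eq_add_of_le' hg.pos.2
    obtain ⟨f', hf'⟩ := hf.exists_heq ⟨⟨x⟩⟩ ⟨⟨y⟩⟩ rfl rfl
    obtain ⟨g', hg'⟩ := hg.exists_heq ⟨⟨y⟩⟩ ⟨⟨z⟩⟩ rfl rfl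
    obtain rfl := eq_of_heq hf'
    obtain rfl := eq_of_heq hg'
    exact functorG.map_comp f' g' ▸ IsGArrow.mk (f' ≫ g')

/-! ## Friezes -/

/-- A frieze: a set of segments `[a, b]` in `ℤ - {0}` (given by their end points `a < b`) that is
nonoverlapping, exhausts `ℤ - {0}`, whose cups are of the form `[2k+2, 2k+3]` and whose caps are
of the form `[-(2k+2), -(2k+1)]`. -/
structure IsFrieze (D : Set (ℤ × ℤ)) : Prop where
  segment : ∀ {a b : ℤ}, (a, b) ∈ D → a < b ∧ a ≠ 0 ∧ b ≠ 0
  /-- Distinct segments are disjoint or one of them encloses the other. -/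
  nonoverlapping : ∀ {a b c d : ℤ}, (a, b) ∈ D → (c, d) ∈ D → (a, b) ≠ (c, d) →
    (b < c ∨ d < a) ∨ (a < c ∧ d < b) ∨ (c < a ∧ b < d)
  exhausts : ∀ a : ℤ, a ≠ 0 → ∃ b, (a, b) ∈ D ∨ (b, a) ∈ D
  cup : ∀ {a b : ℤ}, (a, b) ∈ D → 0 < a → ∃ k : ℕ, a = 2 * k + 2 ∧ b = 2 * k + 3
  cap : ∀ {a b : ℤ}, (a, b) ∈ D → b < 0 → ∃ k : ℕ, a = -(2 * k + 2) ∧ b = -(2 * k + 1)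

/-- `D` is of type `(n, m)`: it contains `[-(m+k), n+k]` for every `k ≥ 1`. -/
def HasType (D : Set (ℤ × ℤ)) (n m : ℕ) : Prop :=
  ∀ k : ℕ, 1 ≤ k → (-((m : ℤ) + k), (n : ℤ) + k) ∈ D

/-- The unit frieze. -/
def unitFrieze : Set (ℤ × ℤ) := {s | ∃ k : ℕ, s = (-((k : ℤ) + 1), (k : ℤ) + 1)}

/-- The three horizontal lines in the diagram of two friezes drawn one above the other. -/
inductive Level
  | top | middle | bottom

/-- The point of a diagram given by a nonzero integer `a`, for a frieze drawn between the lines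
`u` (carrying `1, 2, 3, …`) and `l` (carrying `-1, -2, -3, …`). -/
def place (u l : Level) (a : ℤ) : Level × ℕ := if 0 < a then (u, a.natAbs) else (l, a.natAbs)

/-- Two points are joined by a segment when `D₁` is drawn above `D₂`, the point `-k` of `D₁` being
identified with the point `k` of `D₂`. -/
inductive Joined (D₂ D₁ : Set (ℤ × ℤ)) : Level × ℕ → Level × ℕ → Prop
  | upper {a b : ℤ} : (a, b) ∈ D₁ → Joined D₂ D₁ (place .top .middle a) (place .top .middle b)
  | lower {a b : ℤ} : (a, b) ∈ D₂ → Joined D₂ D₁ (place .middle .bottom a) (place .middle .bottom b)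

/-- The composition `D₂ ∘ D₁`: draw `D₁` above `D₂` and keep the segments `[a, b]` whose end points,
on the top and bottom lines, are connected in the resulting diagram. -/
def friezeComp (D₂ D₁ : Set (ℤ × ℤ)) : Set (ℤ × ℤ) :=
  {s | s.1 < s.2 ∧ s.1 ≠ 0 ∧ s.2 ≠ 0 ∧
    Relation.EqvGen (Joined D₂ D₁) (place .top .bottom s.1) (place .top .bottom s.2)}

/-- The friezes of type `(n, m)`. -/
def Frieze (n m : ℕ) : Type := {D : Set (ℤ × ℤ) // IsFrieze D ∧ HasType D n m}

/-- The assertion that friezes of finite type, with the unit frieze and the composition of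
friezes, satisfy the axioms of a category. -/
structure FriezesCompose : Prop where
  unit : ∀ n : ℕ, IsFrieze unitFrieze ∧ HasType unitFrieze n n
  comp : ∀ {n m l : ℕ} (D₁ : Frieze n m) (D₂ : Frieze m l),
    IsFrieze (friezeComp D₂.1 D₁.1) ∧ HasType (friezeComp D₂.1 D₁.1) n l
  comp_unit : ∀ {n m : ℕ} (D : Frieze n m), friezeComp D.1 unitFrieze = D.1
  unit_comp : ∀ {n m : ℕ} (D : Frieze n m), friezeComp unitFrieze D.1 = D.1
  assoc : ∀ {n m l p : ℕ} (D₁ : Frieze n m) (D₂ : Frieze m l) (D₃ : Frieze l p),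
    friezeComp D₃.1 (friezeComp D₂.1 D₁.1) = friezeComp (friezeComp D₃.1 D₂.1) D₁.1

/-- Objects: the natural numbers with the property `p`. -/
structure FriezeCat (h : FriezesCompose) (p : ℕ → Prop) where
  n : ℕ
  prop : p n

/-- The category of friezes: arrows from `n` to `m` are the friezes of type `(n, m)`. -/
instance FriezeCat.category (h : FriezesCompose) (p : ℕ → Prop) :
    Category.{0} (FriezeCat h p) where
  Hom X Y := Frieze X.n Y.n
  id X := ⟨unitFrieze, h.unit X.n⟩
  comp D₁ D₂ := ⟨friezeComp D₂.1 D₁.1, h.comp D₁ D₂⟩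
  id_comp D := Subtype.ext (h.comp_unit D)
  comp_id D := Subtype.ext (h.unit_comp D)
  assoc D₁ D₂ D₃ := Subtype.ext (h.assoc D₁ D₂ D₃)

/-- The set of segments of an arrow in a category of friezes. -/
def FriezeCat.segs {h : FriezesCompose} {p : ℕ → Prop} {X Y : FriezeCat h p} (D : X ⟶ Y) :
    Set (ℤ × ℤ) :=
  (show Frieze X.n Y.n from D).1

/-- The category `D_A`: objects are the odd natural numbers. -/
abbrev DA (h : FriezesCompose) : Type := FriezeCat h Odd

/-- The category `D_B`: objects are the even natural numbers. -/
abbrev DB (h : FriezesCompose) : Type := FriezeCat h Even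

/-- The functor `D_A ⥤ D_B` that sends `n` to `n + 1` and leaves the friezes unchanged. -/
def shift (h : FriezesCompose) : DA h ⥤ DB h where
  obj X := ⟨X.n + 1, X.prop.add_odd odd_one⟩
  map {X Y} D := show Frieze (X.n + 1) (Y.n + 1) from
    ⟨D.1, D.2.1, fun k hk => by
      have := D.2.2 (k + 1) (Nat.le_add_left _ _)
      push_cast at this ⊢
      rwa [add_assoc, add_assoc, add_comm (1 : ℤ) k]⟩

/-- The subcategory of `D_B` of the arrows from `n` to `m`, with `n, m > 0`, that contain the
transversal segment `[-m, n]`. -/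
def DBLast (h : FriezesCompose) : Subcat (DB h) where
  obj X := 0 < X.n
  hom X Y D := 0 < X.n ∧ 0 < Y.n ∧ (-(Y.n : ℤ), (X.n : ℤ)) ∈ FriezeCat.segs D
  src_mem h := h.1
  tgt_mem h := h.2.1
  id_mem {X} hX := by
    refine ⟨hX, hX, X.n - 1, ?_⟩
    have : ((X.n - 1 : ℕ) : ℤ) + 1 = X.n := by omega
    rw [this]
  comp_mem {X Y Z D₁ D₂} h₁ h₂ := by
    obtain ⟨hX, hY, h₁⟩ := h₁
    obtain ⟨_, hZ, h₂⟩ := h₂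
    refine ⟨hX, hZ, ?_⟩
    change _ ∈ friezeComp (FriezeCat.segs D₂) (FriezeCat.segs D₁)
    refine ⟨by change -(Z.n : ℤ) < X.n; omega, by change -(Z.n : ℤ) ≠ 0; omega,
      by change (X.n : ℤ) ≠ 0; omega, ?_⟩
    have e₁ := Joined.upper (D₂ := FriezeCat.segs D₂) h₁
    have e₂ := Joined.lower (D₁ := FriezeCat.segs D₁) h₂
    simp only [place, Int.neg_pos, Int.natAbs_neg, Int.natAbs_natCast, Nat.cast_pos, hX, hY,
      if_true] at e₁ e₂ ⊢
    exact (Relation.EqvGen.rel _ _ e₂).trans _ _ _ (Relation.EqvGen.rel _ _ e₁)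

/-- In the frieze `D` the odd transversal segment `[-(2k₁+1), 2k₂+1]` and the transversal segment
`[-(2k₁+2), 2k₂+2k₃+2]` (by nonoverlapping, necessarily its successor) form a transversal pair;
it covers the natural number `i` and assigns `k₁` to it. -/
def Assigns (D : Set (ℤ × ℤ)) (i k₁ : ℕ) : Prop :=
  ∃ k₂ k₃ : ℕ, (-(2 * (k₁ : ℤ) + 1), 2 * (k₂ : ℤ) + 1) ∈ D ∧
    (-(2 * (k₁ : ℤ) + 2), 2 * (k₂ : ℤ) + 2 * k₃ + 2) ∈ D ∧ k₂ ≤ i ∧ i ≤ k₂ + k₃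

end FreeAdj

namespace FreeAdj

-- Arrow terms and friezes are both interpreted by monotone functions, and the interpretation is
-- shown to be bijective on arrows.
--
-- In the interpretation of terms, `G` forgets that a function preserves the last element, `F`
-- adjoins a last element to source and target, `phi` to the source only and `gam` to the target
-- only. Asking whether the top value is attained peels any monotone function into these operations
-- (`exists_term`), which gives fullness. For faithfulness, compositions are eliminated
-- (`exists_comp_normal`), and the same question reads the outermost operation off the function of a
-- normal term (`ANormal.eval_inj`, `BNormal.eval_inj`).
--
-- The strands of a frieze of finite type bound regions of two alternating colours. A region of one
-- colour meets the bottom line in a single interval, one of the other colour meets the top line in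
-- a single interval. Following regions down and up yields functions `u` and `l` on `ℕ` that form a
-- Galois connection, and the frieze is recovered from them (`isFrieze_galoisFrieze`,
-- `IsFrieze.exists_eq_galoisFrieze`). A strand is determined by the two regions that it separates.
-- Region labels are constant along connected points of a stacked diagram, and explicit paths supply
-- the converse, so stacking friezes composes Galois connections (`friezeComp_galoisFrieze`). The
-- category axioms are then those of functions. Type `(2n, 2m)` says that `u` and `l` are shifts
-- from `n` and `m` on, so `u` amounts to a monotone function from `n` to `m`; the segment `[-2m,
-- 2n]` records preservation of the last element.

/-! ## Evaluation of arrow terms in the simplicial category -/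

/-- Extend an order-preserving function into a nonempty ordinal by mapping a new last element
to the last element. -/
def snocLast {n m : ℕ} (f : Fin n →o Fin (m + 1)) : Fin (n + 1) →o Fin (m + 1) where
  toFun := Fin.lastCases (Fin.last m) f
  monotone' i j hij := by
    induction j using Fin.lastCases with
    | last => simpa using Fin.le_last _
    | cast j =>
      induction i using Fin.lastCases with
      | last => exact absurd hij (not_le.2 (Fin.castSucc_lt_last j))
      | cast i => simpa using f.monotone (Fin.castSucc_le_castSucc_iff.1 hij)

@[simp]
theorem snocLast_last {n m : ℕ} (f : Fin n →o Fin (m + 1)) :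
    snocLast f (Fin.last n) = Fin.last m :=
  Fin.lastCases_last (motive := fun _ => Fin (m + 1))

@[simp]
theorem snocLast_castSucc {n m : ℕ} (f : Fin n →o Fin (m + 1)) (i : Fin n) :
    snocLast f i.castSucc = f i :=
  Fin.lastCases_castSucc (motive := fun _ => Fin (m + 1)) i

/-- The inclusion of an ordinal in its successor as an initial segment. -/
def castSuccHom (m : ℕ) : Fin m →o Fin (m + 1) := ⟨Fin.castSucc, fun _ _ h => h⟩

@[simp]
theorem castSuccHom_apply {m : ℕ} (i : Fin m) : castSuccHom m i = i.castSucc := rfl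

theorem ext_last {n m : ℕ} {f g : Fin (n + 1) →o Fin m} (h : f (Fin.last n) = g (Fin.last n))
    (h' : ∀ i : Fin n, f i.castSucc = g i.castSucc) : f = g := by
  refine OrderHom.ext _ _ (funext fun i => ?_)
  induction i using Fin.lastCases with
  | last => exact h
  | cast i => exact h' i

mutual
/-- The order-preserving function denoted by an arrow term of `A`. -/
def ATerm.eval : {a₁ a₂ : AObj} → ATerm a₁ a₂ → (Fin (a₁.base.n + 1) →o Fin (a₂.base.n + 1))
  | _, _, .id _ => OrderHom.id
  | _, _, .comp f₂ f₁ => f₂.eval.comp f₁.eval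
  | _, _, .F g => snocLast ((castSuccHom _).comp g.eval)
  | _, _, .phi f => snocLast f.eval
/-- The order-preserving function denoted by an arrow term of `B`. -/
def BTerm.eval : {b₁ b₂ : BObj} → BTerm b₁ b₂ → (Fin b₁.n →o Fin b₂.n)
  | _, _, .id _ => OrderHom.id
  | _, _, .comp g₂ g₁ => g₂.eval.comp g₁.eval
  | _, _, .G f => f.eval
  | _, _, .gam g => (castSuccHom _).comp g.eval
end

/-- Adjoining a last element commutes with a later function only if that function preserves last
elements; the equations `nat₁` and `triangle` of `A` depend on this. -/
theorem ATerm.eval_last : {a₁ a₂ : AObj} → (f : ATerm a₁ a₂) → f.eval (Fin.last _) = Fin.last _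
  | _, _, .id _ => rfl
  | _, _, .comp f₂ f₁ => by
    simp [ATerm.eval, f₁.eval_last, f₂.eval_last]
  | _, _, .F g => by simp [ATerm.eval]
  | _, _, .phi f => by simp [ATerm.eval]

mutual
theorem AEq.eval_eq : {a₁ a₂ : AObj} → {f g : ATerm a₁ a₂} → AEq f g → f.eval = g.eval
  | _, _, _, _, .refl _ => rfl
  | _, _, _, _, .symm h => h.eval_eq.symm
  | _, _, _, _, .trans h h' => h.eval_eq.trans h'.eval_eq
  | _, _, _, _, .congr_comp h h' => by rw [ATerm.eval, ATerm.eval, h.eval_eq, h'.eval_eq]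
  | _, _, _, _, .congr_F h => by rw [ATerm.eval, ATerm.eval, h.eval_eq]
  | _, _, _, _, .congr_phi h => by rw [ATerm.eval, ATerm.eval, h.eval_eq]
  | _, _, _, _, .cat_right _ => rfl
  | _, _, _, _, .cat_left _ => rfl
  | _, _, _, _, .cat_assoc _ _ _ => rfl
  | _, _, _, _, .fun_id _ =>
    ext_last (by simp [ATerm.eval]) (fun i => by simp [ATerm.eval, BTerm.eval])
  | _, _, _, _, .fun_comp _ _ =>
    ext_last (by simp [ATerm.eval]) (fun i => by simp [ATerm.eval, BTerm.eval])
  | _, _, _, _, .nat₁ f₂ _ =>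
    ext_last (by simp [ATerm.eval, f₂.eval_last]) (fun i => by simp [ATerm.eval])
  | _, _, _, _, .nat₂ _ _ =>
    ext_last (by simp [ATerm.eval]) (fun i => by simp [ATerm.eval, BTerm.eval])
  | _, _, _, _, .triangle f _ =>
    ext_last (by simp [ATerm.eval, f.eval_last]) (fun i => by simp [ATerm.eval, BTerm.eval])
theorem BEq.eval_eq : {b₁ b₂ : BObj} → {f g : BTerm b₁ b₂} → BEq f g → f.eval = g.eval
  | _, _, _, _, .refl _ => rfl
  | _, _, _, _, .symm h => h.eval_eq.symm
  | _, _, _, _, .trans h h' => h.eval_eq.trans h'.eval_eq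
  | _, _, _, _, .congr_comp h h' => by rw [BTerm.eval, BTerm.eval, h.eval_eq, h'.eval_eq]
  | _, _, _, _, .congr_G h => by rw [BTerm.eval, BTerm.eval, h.eval_eq]
  | _, _, _, _, .congr_gam h => by rw [BTerm.eval, BTerm.eval, h.eval_eq]
  | _, _, _, _, .cat_right _ => rfl
  | _, _, _, _, .cat_left _ => rfl
  | _, _, _, _, .cat_assoc _ _ _ => rfl
  | _, _, _, _, .fun_id _ => rfl
  | _, _, _, _, .fun_comp _ _ => rfl
  | _, _, _, _, .nat₁ _ _ => rfl
  | _, _, _, _, .nat₂ _ _ => by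
    refine OrderHom.ext _ _ (funext fun i => ?_)
    simp [ATerm.eval, BTerm.eval]
  | _, _, _, _, .triangle _ _ => by
    refine OrderHom.ext _ _ (funext fun i => ?_)
    simp [ATerm.eval, BTerm.eval]
end

/-! ## Surjectivity of the evaluation -/

/-- An order-preserving function that avoids the last element, with codomain restricted. -/
def castPredHom {n m : ℕ} (f : Fin n →o Fin (m + 1)) (h : ∀ i, f i ≠ Fin.last m) :
    Fin n →o Fin m :=
  ⟨fun i => (f i).castPred (h i), fun _ _ hij => Fin.castPred_le_castPred_iff.2 (f.monotone hij)⟩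

/-- If the last value is not attained (for `A`: not before the last argument), the outermost
operation is `gam` or `F`. If it is attained, monotonicity makes the function, or its restriction,
preserve the last element, and the operation is `G` or `phi`. -/
theorem exists_term (k : ℕ) :
    (∀ n m, n + m = k → ∀ f : Fin n →o Fin m, ∃ t : BTerm ⟨n⟩ ⟨m⟩, t.eval = f) ∧
    (∀ n m, n + m = k → ∀ f : Fin (n + 1) →o Fin (m + 1), f (Fin.last n) = Fin.last m →
      ∃ t : ATerm ⟨⟨n⟩⟩ ⟨⟨m⟩⟩, t.eval = f) := by
  induction k using Nat.strong_induction_on with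
  | _ k ih =>
    -- Proved first, because the `F` case of the second claim uses it at the same `k`.
    have hB : ∀ n m, n + m = k → ∀ f : Fin n →o Fin m, ∃ t : BTerm ⟨n⟩ ⟨m⟩, t.eval = f := by
      rintro n (_ | m) rfl f
      · cases n with
        | zero => exact ⟨.id _, OrderHom.ext _ _ (funext fun i => i.elim0)⟩
        | succ n => exact (f 0).elim0
      · by_cases h : ∀ i, f i ≠ Fin.last m
        · obtain ⟨t, ht⟩ := (ih (n + m) (by omega)).1 n m rfl (castPredHom f h)
          refine ⟨.gam t, OrderHom.ext _ _ (funext fun i => ?_)⟩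
          simp only [BTerm.eval, ht]
          exact Fin.castSucc_castPred _ (h i)
        · push Not at h
          obtain ⟨i, hi⟩ := h
          cases n with
          | zero => exact i.elim0
          | succ n =>
            obtain ⟨t, ht⟩ := (ih (n + m) (by omega)).2 n m rfl f
              (le_antisymm (Fin.le_last _) (hi ▸ f.monotone (Fin.le_last i)))
            exact ⟨.G t, ht⟩
    refine ⟨hB, ?_⟩
    rintro n m rfl f hf
    by_cases h : ∀ i : Fin n, f i.castSucc ≠ Fin.last m
    · obtain ⟨t, ht⟩ := hB n m rfl (castPredHom (f.comp (castSuccHom n)) h)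
      refine ⟨.F t, ext_last ?_ fun i => ?_⟩
      · simp [ATerm.eval, hf]
      · simp [ATerm.eval, ht, castPredHom]
    · push Not at h
      obtain ⟨i, hi⟩ := h
      cases n with
      | zero => exact i.elim0
      | succ n =>
        obtain ⟨t, ht⟩ := (ih (n + m) (by omega)).2 n m rfl (f.comp (castSuccHom _))
          (le_antisymm (Fin.le_last _) (hi ▸ f.monotone
            (Fin.castSucc_le_castSucc_iff.2 (Fin.le_last i))))
        refine ⟨.phi t, ext_last ?_ fun i => ?_⟩
        · simp [ATerm.eval, hf]
        · simp [ATerm.eval, ht]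

/-! ## Normal forms: terms without composition and without superfluous identities -/

mutual
/-- Normal arrow terms of `A`. -/
inductive ANormal : ℕ → ℕ → Type
  | F {n m : ℕ} (g : BNormal n m) : ANormal n m
  | phi {n m : ℕ} (f : ANormal n m) : ANormal (n + 1) m
/-- Normal arrow terms of `B`. -/
inductive BNormal : ℕ → ℕ → Type
  | nil : BNormal 0 0
  | G {n m : ℕ} (f : ANormal n m) : BNormal (n + 1) (m + 1)
  | gam {n m : ℕ} (g : BNormal n m) : BNormal n (m + 1)
end

mutual
/-- The arrow term of `A` underlying a normal one. -/
def ANormal.term : {n m : ℕ} → ANormal n m → ATerm ⟨⟨n⟩⟩ ⟨⟨m⟩⟩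
  | _, _, .F g => .F g.term
  | _, _, .phi f => .phi f.term
/-- The arrow term of `B` underlying a normal one. -/
def BNormal.term : {n m : ℕ} → BNormal n m → BTerm ⟨n⟩ ⟨m⟩
  | _, _, .nil => .id _
  | _, _, .G f => .G f.term
  | _, _, .gam g => .gam g.term
end

mutual
/-- The number of operations in a normal arrow term of `A`. -/
def ANormal.size : {n m : ℕ} → ANormal n m → ℕ
  | _, _, .F g => g.size + 1
  | _, _, .phi f => f.size + 1
/-- The number of operations in a normal arrow term of `B`. -/
def BNormal.size : {n m : ℕ} → BNormal n m → ℕ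
  | _, _, .nil => 0
  | _, _, .G f => f.size + 1
  | _, _, .gam g => g.size + 1
end

/-- Composition elimination for normal terms. -/
theorem exists_comp_normal (k : ℕ) :
    (∀ {n m p : ℕ} (f : ANormal n m) (g : ANormal m p), f.size + g.size = k →
      ∃ h : ANormal n p, AEq (.comp g.term f.term) h.term) ∧
    (∀ {n m p : ℕ} (f : BNormal n m) (g : BNormal m p), f.size + g.size = k →
      ∃ h : BNormal n p, BEq (.comp g.term f.term) h.term) := by
  induction k using Nat.strong_induction_on with
  | _ k ih =>
    constructor
    · intro n m p f g hk
      cases f with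
      | phi f =>
        obtain ⟨h, hh⟩ := (ih _ (by rw [← hk, ANormal.size]; omega)).1 f g rfl
        exact ⟨.phi h, (AEq.nat₁ _ _).trans (.congr_phi hh)⟩
      | F f =>
        cases g with
        | F g =>
          obtain ⟨h, hh⟩ := (ih _ (by rw [← hk, ANormal.size, ANormal.size]; omega)).2 f g rfl
          exact ⟨.F h, (AEq.fun_comp _ _).trans (.congr_F hh)⟩
        | phi g =>
          cases f with
          | G f =>
            obtain ⟨h, hh⟩ := (ih _ (by
              rw [← hk, ANormal.size, ANormal.size, BNormal.size]; omega)).1 f g rfl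
            exact ⟨.phi h, (AEq.nat₂ _ _).trans (.congr_phi hh)⟩
          -- The triangle equation cancels `phi` against `gam`; what remains is `g` composed with
          -- the shorter normal term `F f`.
          | gam f =>
            obtain ⟨h, hh⟩ := (ih _ (by
              rw [← hk, ANormal.size, ANormal.size, ANormal.size, BNormal.size]; omega)).1
              (.F f) g rfl
            exact ⟨h, (AEq.triangle _ _).trans hh⟩
    · intro n m p f g hk
      cases g with
      | nil => exact ⟨f, .cat_left _⟩
      | gam g =>
        obtain ⟨h, hh⟩ := (ih _ (by rw [← hk, BNormal.size]; omega)).2 f g rfl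
        exact ⟨.gam h, (BEq.nat₁ _ _).trans (.congr_gam hh)⟩
      | G g =>
        cases f with
        | G f =>
          obtain ⟨h, hh⟩ := (ih _ (by rw [← hk, BNormal.size, BNormal.size]; omega)).1 f g rfl
          exact ⟨.G h, (BEq.fun_comp _ _).trans (.congr_G hh)⟩
        | gam f =>
          cases g with
          | F g =>
            obtain ⟨h, hh⟩ := (ih _ (by
              rw [← hk, BNormal.size, BNormal.size, ANormal.size]; omega)).2 f g rfl
            exact ⟨.gam h, (BEq.nat₂ _ _).trans (.congr_gam hh)⟩
          | phi g =>
            obtain ⟨h, hh⟩ := (ih _ (by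
              rw [← hk, BNormal.size, BNormal.size, BNormal.size, ANormal.size]; omega)).2
              f (.G g) rfl
            exact ⟨h, (BEq.triangle _ _).trans hh⟩

/-- `nil` is the only identity among normal terms, so the others are expanded by the functor laws
down to `∅`. -/
theorem exists_id_normal : ∀ n : ℕ, ∃ h : BNormal n n, BEq (.id ⟨n⟩) h.term
  | 0 => ⟨.nil, .refl _⟩
  | n + 1 => by
    obtain ⟨h, hh⟩ := exists_id_normal n
    exact ⟨.G (.F h), (BEq.fun_id ⟨⟨n⟩⟩).symm.trans
      (.congr_G ((AEq.fun_id ⟨n⟩).symm.trans (.congr_F hh)))⟩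

mutual
theorem ATerm.exists_normal : {a₁ a₂ : AObj} → (f : ATerm a₁ a₂) →
    ∃ h : ANormal a₁.base.n a₂.base.n, AEq f h.term
  | a, _, .id _ => by
    obtain ⟨h, hh⟩ := exists_id_normal a.base.n
    exact ⟨.F h, (AEq.fun_id a.base).symm.trans (.congr_F hh)⟩
  | _, _, .comp f₂ f₁ => by
    obtain ⟨h₁, hh₁⟩ := f₁.exists_normal
    obtain ⟨h₂, hh₂⟩ := f₂.exists_normal
    obtain ⟨h, hh⟩ := (exists_comp_normal _).1 h₁ h₂ rfl
    exact ⟨h, (AEq.congr_comp hh₂ hh₁).trans hh⟩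
  | _, _, .F g => by
    obtain ⟨h, hh⟩ := g.exists_normal
    exact ⟨.F h, .congr_F hh⟩
  | _, _, .phi f => by
    obtain ⟨h, hh⟩ := f.exists_normal
    exact ⟨.phi h, .congr_phi hh⟩
theorem BTerm.exists_normal : {b₁ b₂ : BObj} → (g : BTerm b₁ b₂) →
    ∃ h : BNormal b₁.n b₂.n, BEq g h.term
  | b, _, .id _ => exists_id_normal b.n
  | _, _, .comp g₂ g₁ => by
    obtain ⟨h₁, hh₁⟩ := g₁.exists_normal
    obtain ⟨h₂, hh₂⟩ := g₂.exists_normal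
    obtain ⟨h, hh⟩ := (exists_comp_normal _).2 h₁ h₂ rfl
    exact ⟨h, (BEq.congr_comp hh₂ hh₁).trans hh⟩
  | _, _, .G f => by
    obtain ⟨h, hh⟩ := f.exists_normal
    exact ⟨.G h, .congr_G hh⟩
  | _, _, .gam g => by
    obtain ⟨h, hh⟩ := g.exists_normal
    exact ⟨.gam h, .congr_gam hh⟩
end

-- Uniqueness of normal forms

theorem castSuccHom_comp_inj {n m : ℕ} {f g : Fin n →o Fin m}
    (h : (castSuccHom m).comp f = (castSuccHom m).comp g) : f = g :=
  OrderHom.ext _ _ (funext fun i => Fin.castSucc_injective _ (DFunLike.congr_fun h i))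

theorem snocLast_inj {n m : ℕ} {f g : Fin n →o Fin (m + 1)} (h : snocLast f = snocLast g) :
    f = g :=
  OrderHom.ext _ _ (funext fun i => by simpa using DFunLike.congr_fun h i.castSucc)

/-- The penultimate argument distinguishes `F` from `phi`: only under `phi` is it sent to the last
element. -/
theorem snocLast_castSuccHom_ne {n m : ℕ} (g : Fin (n + 1) →o Fin m)
    (f : ATerm ⟨⟨n⟩⟩ ⟨⟨m⟩⟩) : snocLast ((castSuccHom m).comp g) ≠ snocLast f.eval := fun h => by
  have := DFunLike.congr_fun h (Fin.last n).castSucc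
  rw [snocLast_castSucc, snocLast_castSucc, f.eval_last] at this
  exact (Fin.castSucc_lt_last _).ne this

/-- The last argument distinguishes `gam` from `G`. -/
theorem castSuccHom_comp_ne {n m : ℕ} (g : Fin (n + 1) →o Fin m)
    (f : ATerm ⟨⟨n⟩⟩ ⟨⟨m⟩⟩) : (castSuccHom m).comp g ≠ f.eval := fun h => by
  have := DFunLike.congr_fun h (Fin.last n)
  rw [f.eval_last] at this
  exact (Fin.castSucc_lt_last _).ne this

mutual
theorem ANormal.eval_inj : {n m : ℕ} → (f g : ANormal n m) → f.term.eval = g.term.eval → f = g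
  | _, _, .F f, .F g, h => by rw [f.eval_inj g (castSuccHom_comp_inj (snocLast_inj h))]
  | _, _, .F f, .phi g, h => absurd h (snocLast_castSuccHom_ne _ _)
  | _, _, .phi f, .F g, h => absurd h.symm (snocLast_castSuccHom_ne _ _)
  | _, _, .phi f, .phi g, h => by rw [f.eval_inj g (snocLast_inj h)]
theorem BNormal.eval_inj : {n m : ℕ} → (f g : BNormal n m) → f.term.eval = g.term.eval → f = g
  | _, _, .nil, .nil, _ => rfl
  | _, _, .G f, .G g, h => by rw [f.eval_inj g h]
  | _, _, .G f, .gam g, h => absurd h.symm (castSuccHom_comp_ne _ _)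
  | _, _, .gam f, .G g, h => absurd h (castSuccHom_comp_ne _ _)
  | _, _, .gam f, .gam g, h => by rw [f.eval_inj g (castSuccHom_comp_inj h)]
end

theorem ATerm.eq_of_eval_eq {a₁ a₂ : AObj} {f g : ATerm a₁ a₂} (h : f.eval = g.eval) :
    AEq f g := by
  obtain ⟨f', hf⟩ := f.exists_normal
  obtain ⟨g', hg⟩ := g.exists_normal
  obtain rfl := f'.eval_inj g' (hf.eval_eq.symm.trans (h.trans hg.eval_eq))
  exact hf.trans hg.symm

theorem BTerm.eq_of_eval_eq {b₁ b₂ : BObj} {f g : BTerm b₁ b₂} (h : f.eval = g.eval) :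
    BEq f g := by
  obtain ⟨f', hf⟩ := f.exists_normal
  obtain ⟨g', hg⟩ := g.exists_normal
  obtain rfl := f'.eval_inj g' (hf.eval_eq.symm.trans (h.trans hg.eval_eq))
  exact hf.trans hg.symm

/-! ## The isomorphisms of the free adjunction with categories of order-preserving functions -/

/-- The functor from `B` to the simplicial category. -/
def evalB : BObj ⥤ Delta where
  obj b := ⟨b.n⟩
  map {b₁ b₂} g := show Fin b₁.n →o Fin b₂.n from
    Quotient.lift BTerm.eval (fun _ _ h => BEq.eval_eq h) g
  map_id _ := rfl
  map_comp := by rintro _ _ _ ⟨f⟩ ⟨g⟩; rfl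

/-- The functor from `A` to the category of last-element-preserving functions. -/
def evalA : AObj ⥤ deltaLast.Cat where
  obj a := ⟨⟨a.base.n + 1⟩, Nat.succ_pos _⟩
  map f := ⟨evalB.map (functorG.map f), by
    obtain ⟨f⟩ := f
    exact ⟨Nat.succ_pos _, Nat.succ_pos _, f.eval_last⟩⟩
  map_id a := Subtype.ext (by
    change evalB.map (functorG.map (𝟙 a)) = _
    rw [functorG.map_id, evalB.map_id]; rfl)
  map_comp f g := Subtype.ext (by
    change evalB.map (functorG.map (f ≫ g)) = _
    rw [functorG.map_comp, evalB.map_comp]; rfl)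

instance : evalB.IsIso where
  faithful := ⟨by
    rintro _ _ ⟨f⟩ ⟨g⟩ h
    exact Quotient.sound (s := bSetoid _ _) (BTerm.eq_of_eval_eq h)⟩
  full := ⟨by
    rintro X Y f
    obtain ⟨t, ht⟩ := (exists_term _).1 X.n Y.n rfl f
    exact ⟨⟦t⟧, ht⟩⟩
  bijective_obj := ⟨fun _ _ h => congrArg (fun X : Delta => BObj.mk X.n) h, fun X => ⟨⟨X.n⟩, rfl⟩⟩

instance : evalA.IsIso where
  faithful := ⟨by
    rintro _ _ ⟨f⟩ ⟨g⟩ h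
    exact Quotient.sound (s := aSetoid _ _) (ATerm.eq_of_eval_eq (congrArg Subtype.val h))⟩
  full := ⟨by
    rintro X Y ⟨f, _, _, hf⟩
    obtain ⟨t, ht⟩ := (exists_term _).2 X.base.n Y.base.n rfl f hf
    exact ⟨⟦t⟧, Subtype.ext ht⟩⟩
  bijective_obj := by
    refine ⟨fun X Y h => ?_, ?_⟩
    · have : X.base.n + 1 = Y.base.n + 1 := congrArg (fun X : deltaLast.Cat => X.val.n) h
      obtain ⟨⟨n⟩⟩ := X
      obtain ⟨⟨m⟩⟩ := Y
      obtain rfl : n = m := Nat.succ.inj this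
      rfl
    · rintro ⟨⟨_ | n⟩, h⟩
      · exact absurd h (lt_irrefl _)
      · exact ⟨⟨⟨n⟩⟩, rfl⟩

/-- The corestriction of `G` to its image. -/
def toImageG : AObj ⥤ imageG.Cat where
  obj a := ⟨GObj a, Nat.le_add_left _ _⟩
  map f := ⟨functorG.map f, .mk f⟩
  map_id a := Subtype.ext (functorG.map_id a)
  map_comp f g := Subtype.ext (functorG.map_comp f g)

instance : toImageG.IsIso where
  faithful := ⟨by
    intro X Y f g h
    -- `evalA` factors through `functorG`, so its faithfulness passes to `functorG`.
    exact evalA.map_injective (Subtype.ext (congrArg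
      (fun k : toImageG.obj X ⟶ toImageG.obj Y => evalB.map k.1) h))⟩
  full := ⟨by
    rintro X Y ⟨f, hf⟩
    obtain ⟨f', h⟩ := IsGArrow.exists_heq hf X Y rfl rfl
    exact ⟨f', Subtype.ext (eq_of_heq h).symm⟩⟩
  bijective_obj := by
    refine ⟨fun X Y h => ?_, ?_⟩
    · have : X.base.n + 1 = Y.base.n + 1 := congrArg (fun X : imageG.Cat => X.val.n) h
      obtain ⟨⟨n⟩⟩ := X
      obtain ⟨⟨m⟩⟩ := Y
      obtain rfl : n = m := Nat.succ.inj this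
      rfl
    · rintro ⟨⟨_ | n⟩, h⟩
      · exact absurd h (Nat.not_succ_le_zero 0)
      · exact ⟨⟨⟨n⟩⟩, rfl⟩

/-! ## Elementary properties of friezes -/

/-- Every nonzero integer is of the form `±(2i+1)` or `±(2i+2)`. -/
theorem exists_nat_of_ne_zero {a : ℤ} (ha : a ≠ 0) : ∃ i : ℕ,
    a = 2 * i + 1 ∨ a = 2 * i + 2 ∨ a = -(2 * i + 1) ∨ a = -(2 * i + 2) :=
  ⟨(a.natAbs - 1) / 2, by omega⟩

namespace IsFrieze

variable {D D' : Set (ℤ × ℤ)}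

theorem right_unique (h : IsFrieze D) {a b d : ℤ} (h₁ : (a, b) ∈ D) (h₂ : (a, d) ∈ D) :
    b = d := by
  by_contra hne
  have := h.nonoverlapping h₁ h₂ (fun e => hne (congrArg Prod.snd e))
  have := h.segment h₁
  have := h.segment h₂
  omega

theorem left_unique (h : IsFrieze D) {a b c : ℤ} (h₁ : (a, b) ∈ D) (h₂ : (c, b) ∈ D) :
    a = c := by
  by_contra hne
  have := h.nonoverlapping h₁ h₂ (fun e => hne (congrArg Prod.fst e))
  have := h.segment h₁
  have := h.segment h₂
  omega

/-- With `right_unique` and `left_unique`, this makes each nonzero integer an end point of exactly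
one segment. -/
theorem not_chain (h : IsFrieze D) {a b c : ℤ} (h₁ : (a, b) ∈ D) (h₂ : (b, c) ∈ D) : False := by
  have := h.segment h₁
  have := h.segment h₂
  have := h.nonoverlapping h₁ h₂ (fun e => by
    have := congrArg Prod.fst e
    simp only at this
    omega)
  omega

/-- The smaller frieze already uses up every point, and a point of the larger one lies on a single
segment. -/
theorem eq_of_subset (h : IsFrieze D) (h' : IsFrieze D') (hs : D ⊆ D') : D = D' := by
  refine hs.antisymm ?_
  rintro ⟨a, b⟩ hab
  obtain ⟨c, hc | hc⟩ := h.exhausts a (h'.segment hab).2.1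
  · rwa [h'.right_unique hab (hs hc)]
  · exact (h'.not_chain (hs hc) hab).elim

/-- The number of points enclosed by a segment is even. -/
theorem even_enclosed (h : IsFrieze D) {p q : ℕ} (hpq : (-((p : ℤ) + 1), (q : ℤ) + 1) ∈ D) :
    Even (p + q) := by
  classical
  -- `π` sends a point to the other end of its segment. By nonoverlapping it restricts to a
  -- fixed-point-free involution of the enclosed points, so summing `1` over them in `ZMod 2` gives
  -- zero.
  choose! π hπ using h.exhausts
  set S : Finset ℤ := (Finset.Ioo (-((p : ℤ) + 1)) (q + 1)).erase 0 with hS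
  have hmem : ∀ a ∈ S, π a ∈ S ∧ π (π a) = a ∧ π a ≠ a := by
    intro a ha
    simp only [hS, Finset.mem_erase, Finset.mem_Ioo] at ha
    have h₀ : π a ≠ 0 ∧ π a ≠ a := by
      rcases hπ a ha.1 with h₁ | h₁ <;> have := h.segment h₁ <;> omega
    refine ⟨?_, ?_, h₀.2⟩
    · simp only [hS, Finset.mem_erase, Finset.mem_Ioo]
      refine ⟨h₀.1, ?_⟩
      rcases hπ a ha.1 with h₁ | h₁
      · have := h.nonoverlapping h₁ hpq (fun e => by
          have := congrArg Prod.fst e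
          simp only at this
          omega)
        have := h.segment h₁
        omega
      · have := h.nonoverlapping h₁ hpq (fun e => by
          have := congrArg Prod.snd e
          simp only at this
          omega)
        have := h.segment h₁
        omega
    · rcases hπ a ha.1 with h₁ | h₁ <;> rcases hπ _ h₀.1 with h₂ | h₂
      · exact (h.not_chain h₁ h₂).elim
      · exact h.left_unique h₂ h₁
      · exact h.right_unique h₂ h₁
      · exact (h.not_chain h₂ h₁).elim
  have hsum : ∑ _a ∈ S, (1 : ZMod 2) = 0 :=
    Finset.sum_involution (fun a _ => π a) (fun _ _ => by decide)
      (fun a ha _ => (hmem a ha).2.2) (fun a ha => (hmem a ha).1) (fun a ha => (hmem a ha).2.1)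
  have hcard : S.card = p + q := by
    rw [hS, Finset.card_erase_of_mem (by rw [Finset.mem_Ioo]; omega), Int.card_Ioo]
    omega
  rw [Finset.sum_const, nsmul_one, hcard, ZMod.natCast_eq_zero_iff] at hsum
  exact even_iff_two_dvd.2 hsum

/-- The ends `-(p+1)` and `q+1` enclose `p + q` points, an even number, so they have equal parity.
-/
theorem odd_transversal (h : IsFrieze D) {a : ℤ} {i : ℕ} (ha : (a, 2 * (i : ℤ) + 1) ∈ D)
    (ha' : a < 0) : ∃ j : ℕ, a = -(2 * j + 1) := by
  obtain ⟨p, rfl⟩ : ∃ p : ℕ, a = -((p : ℤ) + 1) := ⟨(a + 1).natAbs, by omega⟩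
  obtain ⟨c, hc⟩ := h.even_enclosed (p := p) (q := 2 * i) (by push_cast; exact ha)
  exact ⟨c - i, by omega⟩

theorem even_transversal (h : IsFrieze D) {a : ℤ} {i : ℕ} (ha : (a, 2 * (i : ℤ) + 2) ∈ D)
    (ha' : a < 0) : ∃ j : ℕ, a = -(2 * j + 2) := by
  obtain ⟨p, rfl⟩ : ∃ p : ℕ, a = -((p : ℤ) + 1) := ⟨(a + 1).natAbs, by omega⟩
  obtain ⟨c, hc⟩ := h.even_enclosed (p := p) (q := 2 * i + 1)
    (by push_cast; rwa [add_assoc, one_add_one_eq_two])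
  exact ⟨c - i - 1, by omega⟩

/-- The leftmost possible cup is `[2, 3]`, which leaves only a transversal for the point `1`. -/
theorem zero_top (h : IsFrieze D) : ∃ j : ℕ, (-(2 * (j : ℤ) + 1), 1) ∈ D := by
  obtain ⟨b, hb | hb⟩ := h.exhausts 1 one_ne_zero
  · obtain ⟨k, hk, -⟩ := h.cup hb one_pos
    omega
  · rcases lt_trichotomy b 0 with hlt | rfl | hlt
    · obtain ⟨j, rfl⟩ := h.odd_transversal (i := 0) (by simpa using hb) hlt
      exact ⟨j, hb⟩
    · exact absurd rfl (h.segment hb).2.1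
    · obtain ⟨k, -, hk⟩ := h.cup hb hlt
      omega

theorem odd_top (h : IsFrieze D) (i : ℕ) : (2 * (i : ℤ) + 2, 2 * (i : ℤ) + 3) ∈ D ∨
    ∃ j : ℕ, (-(2 * (j : ℤ) + 1), 2 * (i : ℤ) + 3) ∈ D := by
  obtain ⟨b, hb | hb⟩ := h.exhausts (2 * i + 3) (by omega)
  · obtain ⟨k, hk, -⟩ := h.cup hb (by omega)
    omega
  · rcases lt_trichotomy b 0 with hlt | rfl | hlt
    · obtain ⟨j, rfl⟩ := h.odd_transversal (i := i + 1)
        (by convert hb using 2; push_cast; ring) hlt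
      exact .inr ⟨j, hb⟩
    · exact absurd rfl (h.segment hb).2.1
    · obtain ⟨k, rfl, hk⟩ := h.cup hb hlt
      obtain rfl : k = i := by omega
      exact .inl hb

theorem even_bottom (h : IsFrieze D) (j : ℕ) : (-(2 * (j : ℤ) + 2), -(2 * (j : ℤ) + 1)) ∈ D ∨
    ∃ i : ℕ, (-(2 * (j : ℤ) + 2), 2 * (i : ℤ) + 2) ∈ D := by
  obtain ⟨b, hb | hb⟩ := h.exhausts (-(2 * j + 2)) (by omega)
  · rcases lt_trichotomy b 0 with hlt | rfl | hlt
    · obtain ⟨k, hk, rfl⟩ := h.cap hb hlt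
      obtain rfl : k = j := by omega
      exact .inl hb
    · exact absurd rfl (h.segment hb).2.2
    · obtain ⟨i, rfl | rfl | rfl | rfl⟩ := exists_nat_of_ne_zero hlt.ne'
      · obtain ⟨k, hk⟩ := h.odd_transversal hb (by omega)
        omega
      · exact .inr ⟨i, hb⟩
      all_goals omega
  · obtain ⟨k, -, hk⟩ := h.cap hb (by omega)
    omega

/-! ### The order-preserving function of a frieze -/

/-- Walk left from `2i+1` over adjacent cups until an odd point lies on a transversal; the point `1`
stops the walk at the latest. -/
theorem exists_block (h : IsFrieze D) (i : ℕ) : ∃ k₁ k₂ : ℕ, k₂ ≤ i ∧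
    (-(2 * (k₁ : ℤ) + 1), 2 * (k₂ : ℤ) + 1) ∈ D ∧
    ∀ k : ℕ, k₂ ≤ k → k < i → (2 * (k : ℤ) + 2, 2 * (k : ℤ) + 3) ∈ D := by
  induction i with
  | zero =>
    obtain ⟨j, hj⟩ := h.zero_top
    exact ⟨j, 0, le_rfl, by simpa using hj, fun k _ hk => absurd hk (Nat.not_lt_zero k)⟩
  | succ i ih =>
    rcases h.odd_top i with hi | ⟨j, hj⟩
    · obtain ⟨k₁, k₂, hk, hD, hc⟩ := ih
      refine ⟨k₁, k₂, hk.trans (Nat.le_succ i), hD, fun k hk hki => ?_⟩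
      rcases Nat.lt_succ_iff_lt_or_eq.1 hki with hki | rfl
      · exact hc k hk hki
      · exact hi
    · refine ⟨j, i + 1, le_rfl, ?_, fun k hk hki => absurd hk (Nat.not_le.2 hki)⟩
      convert hj using 2
      push_cast
      ring

/-- The bottom point `-(2k₁+2)` is not on a cap, since that cap would reuse `-(2k₁+1)`. The top end
of its transversal lies beyond the cups found by `exists_block`, whose points are taken. -/
theorem exists_assigns (h : IsFrieze D) (i : ℕ) : ∃ k, Assigns D i k := by
  obtain ⟨k₁, k₂, hk, hD, hc⟩ := h.exists_block i
  rcases h.even_bottom k₁ with hb | ⟨e, he⟩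
  · exact (h.not_chain hb hD).elim
  · have hn := h.nonoverlapping hD he (fun e => by
      have := congrArg Prod.fst e
      simp only at this
      omega)
    have hei : i ≤ e := by
      by_contra hlt
      exact h.not_chain he (hc e (by omega) (by omega))
    obtain ⟨k₃, rfl⟩ : ∃ k₃, e = k₂ + k₃ := ⟨e - k₂, by omega⟩
    refine ⟨k₁, k₂, k₃, hD, ?_, hk, hei⟩
    convert he using 2
    push_cast
    ring

/-- If `k' < k`, the odd transversal for `i` would have to enclose the even one for `i'`, which
forces `i' < i`. -/
theorem assigns_mono (h : IsFrieze D) {i i' k k' : ℕ} (hk : Assigns D i k)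
    (hk' : Assigns D i' k') (hi : i ≤ i') : k ≤ k' := by
  obtain ⟨k₂, k₃, hD, -, hle, -⟩ := hk
  obtain ⟨k₂', k₃', -, hD', -, hle'⟩ := hk'
  by_contra hlt
  have := h.nonoverlapping hD hD' (fun e => by
    have := congrArg Prod.fst e
    simp only at this
    omega)
  omega

theorem assigns_unique (h : IsFrieze D) {i k k' : ℕ} (hk : Assigns D i k)
    (hk' : Assigns D i k') : k = k' :=
  (h.assigns_mono hk hk' le_rfl).antisymm (h.assigns_mono hk' hk le_rfl)

theorem assigns_of_odd (h : IsFrieze D) {i k : ℕ}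
    (hD : (-(2 * (k : ℤ) + 1), 2 * (i : ℤ) + 1) ∈ D) : Assigns D i k := by
  rcases h.even_bottom k with hb | ⟨e, he⟩
  · exact (h.not_chain hb hD).elim
  · have hn := h.nonoverlapping hD he (fun e => by
      have := congrArg Prod.fst e
      simp only at this
      omega)
    refine ⟨i, e - i, hD, ?_, le_rfl, Nat.le_add_right _ _⟩
    convert he using 2
    omega

theorem assigns_of_even (h : IsFrieze D) {i k : ℕ}
    (hD : (-(2 * (k : ℤ) + 2), 2 * (i : ℤ) + 2) ∈ D) : Assigns D i k := by
  obtain ⟨k₁, k₂, k₃, h₁, h₂, hle, hle'⟩ := h.exists_assigns i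
  have hn₁ := fun hne => h.nonoverlapping hD h₁ hne
  have hn₂ := fun hne => h.nonoverlapping hD h₂ hne
  simp only [ne_eq, Prod.mk.injEq] at hn₁ hn₂
  obtain rfl : k = k₁ := by omega
  exact ⟨k₂, k₃, h₁, h₂, hle, hle'⟩

end IsFrieze

/-! ## The frieze of a Galois connection -/

/-- The frieze of a Galois connection on `ℕ` with upper adjoint `u` and lower adjoint `l`. -/
def galoisFrieze (u l : ℕ → ℕ) : Set (ℤ × ℤ) :=
  {s | (∃ k : ℕ, s = (2 * (k : ℤ) + 2, 2 * (k : ℤ) + 3) ∧ u k = u (k + 1)) ∨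
    (∃ j : ℕ, s = (-(2 * (j : ℤ) + 2), -(2 * (j : ℤ) + 1)) ∧ l j = l (j + 1)) ∨
    (∃ i : ℕ, s = (-(2 * (u i : ℤ) + 1), 2 * (i : ℤ) + 1) ∧ l (u i) = i) ∨
    (∃ i : ℕ, s = (-(2 * (u i : ℤ) + 2), 2 * (i : ℤ) + 2) ∧ l (u i + 1) = i + 1)}

section galoisFrieze

variable {u l : ℕ → ℕ}

theorem mk_mem_galoisFrieze {a b : ℤ} : (a, b) ∈ galoisFrieze u l ↔
    (∃ k : ℕ, (a = 2 * (k : ℤ) + 2 ∧ b = 2 * (k : ℤ) + 3) ∧ u k = u (k + 1)) ∨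
    (∃ j : ℕ, (a = -(2 * (j : ℤ) + 2) ∧ b = -(2 * (j : ℤ) + 1)) ∧ l j = l (j + 1)) ∨
    (∃ i : ℕ, (a = -(2 * (u i : ℤ) + 1) ∧ b = 2 * (i : ℤ) + 1) ∧ l (u i) = i) ∨
    (∃ i : ℕ, (a = -(2 * (u i : ℤ) + 2) ∧ b = 2 * (i : ℤ) + 2) ∧ l (u i + 1) = i + 1) := by
  simp only [galoisFrieze, Set.mem_ofPred_eq, Prod.mk.injEq]

theorem odd_mem_galoisFrieze {i j : ℕ} :
    (-(2 * (j : ℤ) + 1), 2 * (i : ℤ) + 1) ∈ galoisFrieze u l ↔ u i = j ∧ l j = i := by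
  rw [mk_mem_galoisFrieze]
  constructor
  · rintro (⟨k, h, -⟩ | ⟨k, h, -⟩ | ⟨k, h, h'⟩ | ⟨k, h, -⟩)
    · omega
    · omega
    · obtain rfl : k = i := by omega
      obtain rfl : u k = j := by omega
      exact ⟨rfl, h'⟩
    · omega
  · rintro ⟨rfl, h⟩
    exact .inr (.inr (.inl ⟨i, ⟨rfl, rfl⟩, h⟩))

theorem even_mem_galoisFrieze {i j : ℕ} :
    (-(2 * (j : ℤ) + 2), 2 * (i : ℤ) + 2) ∈ galoisFrieze u l ↔ u i = j ∧ l (j + 1) = i + 1 := by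
  rw [mk_mem_galoisFrieze]
  constructor
  · rintro (⟨k, h, -⟩ | ⟨k, h, -⟩ | ⟨k, h, -⟩ | ⟨k, h, h'⟩)
    · omega
    · omega
    · omega
    · obtain rfl : k = i := by omega
      obtain rfl : u k = j := by omega
      exact ⟨rfl, h'⟩
  · rintro ⟨rfl, h⟩
    exact .inr (.inr (.inr ⟨i, ⟨rfl, rfl⟩, h⟩))

theorem cup_mem_galoisFrieze {k : ℕ} (h : u k = u (k + 1)) :
    (2 * (k : ℤ) + 2, 2 * (k : ℤ) + 3) ∈ galoisFrieze u l :=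
  mk_mem_galoisFrieze.2 (.inl ⟨k, ⟨rfl, rfl⟩, h⟩)

theorem cap_mem_galoisFrieze {j : ℕ} (h : l j = l (j + 1)) :
    (-(2 * (j : ℤ) + 2), -(2 * (j : ℤ) + 1)) ∈ galoisFrieze u l :=
  mk_mem_galoisFrieze.2 (.inr (.inl ⟨j, ⟨rfl, rfl⟩, h⟩))

/-- Where `u` is constant from `k` to `k + 1` there is a cup; where it jumps, the points `2k+2` and
`2k+3` lie on transversals. The same holds for `l` and caps. The adjunction excludes clashes between
these alternatives and crossings of transversals. -/
theorem isFrieze_galoisFrieze (gc : GaloisConnection l u) : IsFrieze (galoisFrieze u l) where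
  segment {a b} h := by
    rw [mk_mem_galoisFrieze] at h
    rcases h with ⟨k, h, -⟩ | ⟨k, h, -⟩ | ⟨k, h, -⟩ | ⟨k, h, -⟩ <;> omega
  nonoverlapping {a b c d} h₁ h₂ hne := by
    rw [ne_eq, Prod.mk.injEq] at hne
    rw [mk_mem_galoisFrieze] at h₁ h₂
    rcases h₁ with ⟨k, ⟨rfl, rfl⟩, h₁⟩ | ⟨k, ⟨rfl, rfl⟩, h₁⟩ | ⟨k, ⟨rfl, rfl⟩, h₁⟩ |
      ⟨k, ⟨rfl, rfl⟩, h₁⟩ <;>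
    rcases h₂ with ⟨k', ⟨rfl, rfl⟩, h₂⟩ | ⟨k', ⟨rfl, rfl⟩, h₂⟩ | ⟨k', ⟨rfl, rfl⟩, h₂⟩ |
      ⟨k', ⟨rfl, rfl⟩, h₂⟩
    · omega
    · omega
    -- The ends of a cup or cap are consecutive, so against a transversal only a shared end point
    -- has to be excluded.
    · have : k' ≠ k + 1 := by
        rintro rfl
        have := gc (u (k + 1)) k
        omega
      omega
    · have : k' ≠ k := by
        rintro rfl
        have := gc (u k' + 1) (k' + 1)
        omega
      omega
    · omega
    · omega
    · have : k ≠ u k' := by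
        rintro rfl
        have := gc (u k' + 1) k'
        omega
      omega
    · have : k ≠ u k' := by
        rintro rfl
        have := gc (u k') k'
        omega
      omega
    · have : k ≠ k' + 1 := by
        rintro rfl
        have := gc (u (k' + 1)) k'
        omega
      omega
    · have : k' ≠ u k := by
        rintro rfl
        have := gc (u k + 1) k
        omega
      omega
    · have := gc (u k) k'
      have := gc (u k') k
      omega
    · have := gc (u k) k'
      omega
    · have : k' ≠ k := by
        rintro rfl
        have := gc (u k' + 1) (k' + 1)
        omega
      omega
    · have : k' ≠ u k := by
        rintro rfl
        have := gc (u k) k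
        omega
      omega
    · have := gc (u k') k
      omega
    · have := gc (u k + 1) k'
      have := gc (u k' + 1) k
      omega
  exhausts a ha := by
    obtain ⟨i, rfl | rfl | rfl | rfl⟩ := exists_nat_of_ne_zero ha
    · cases i with
      | zero =>
        have := gc (u 0) 0
        exact ⟨_, .inr (odd_mem_galoisFrieze.2 ⟨rfl, by omega⟩)⟩
      | succ k =>
        by_cases h : u k = u (k + 1)
        · refine ⟨2 * k + 2, .inr ?_⟩
          convert cup_mem_galoisFrieze h using 2
          push_cast
          ring
        · have := gc (u (k + 1)) (k + 1)
          have := gc (u (k + 1)) k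
          have := gc.monotone_u (show k ≤ k + 1 by omega)
          exact ⟨_, .inr (odd_mem_galoisFrieze.2 ⟨rfl, by omega⟩)⟩
    · by_cases h : u i = u (i + 1)
      · exact ⟨_, .inl (cup_mem_galoisFrieze h)⟩
      · have := gc (u i + 1) (i + 1)
        have := gc (u i + 1) i
        have := gc.monotone_u (show i ≤ i + 1 by omega)
        exact ⟨_, .inr (even_mem_galoisFrieze.2 ⟨rfl, by omega⟩)⟩
    · by_cases h : l i = l (i + 1)
      · exact ⟨_, .inr (cap_mem_galoisFrieze h)⟩
      · have := gc i (l i)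
        have := gc (i + 1) (l i)
        have := gc.monotone_l (show i ≤ i + 1 by omega)
        exact ⟨_, .inl (odd_mem_galoisFrieze.2 ⟨by omega, rfl⟩)⟩
    · by_cases h : l i = l (i + 1)
      · exact ⟨_, .inl (cap_mem_galoisFrieze h)⟩
      · have := gc i (l (i + 1) - 1)
        have := gc (i + 1) (l (i + 1) - 1)
        have := gc.monotone_l (show i ≤ i + 1 by omega)
        exact ⟨_, .inl (even_mem_galoisFrieze (i := l (i + 1) - 1).2 ⟨by omega, by omega⟩)⟩
  cup {a b} h ha := by
    rw [mk_mem_galoisFrieze] at h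
    rcases h with ⟨k, h, -⟩ | ⟨k, h, -⟩ | ⟨k, h, -⟩ | ⟨k, h, -⟩
    · exact ⟨k, h⟩
    all_goals omega
  cap {a b} h hb := by
    rw [mk_mem_galoisFrieze] at h
    rcases h with ⟨k, h, -⟩ | ⟨k, h, -⟩ | ⟨k, h, -⟩ | ⟨k, h, -⟩
    · omega
    · exact ⟨k, h⟩
    all_goals omega

theorem unitFrieze_eq : unitFrieze = galoisFrieze id id := by
  ext ⟨a, b⟩
  rw [mk_mem_galoisFrieze]
  constructor
  · rintro ⟨k, hk⟩
    rw [Prod.mk.injEq] at hk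
    rcases Nat.even_or_odd' k with ⟨c, rfl | rfl⟩
    · exact .inr (.inr (.inl ⟨c, by simp only [id]; omega, rfl⟩))
    · exact .inr (.inr (.inr ⟨c, by simp only [id]; omega, rfl⟩))
  · rintro (⟨k, -, h⟩ | ⟨k, -, h⟩ | ⟨k, h, -⟩ | ⟨k, h, -⟩)
    · exact absurd h (Nat.succ_ne_self k).symm
    · exact absurd h (Nat.succ_ne_self k).symm
    · exact ⟨2 * k, by rw [Prod.mk.injEq]; simp only [id] at h; omega⟩
    · exact ⟨2 * k + 1, by rw [Prod.mk.injEq]; simp only [id] at h; omega⟩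

-- From friezes of finite type to Galois connections

/-- The lower adjoint sends `j` to the least `i` with `j ≤ u i`; unboundedness of `u` makes it
total. -/
theorem exists_galoisConnection (hu : Monotone u) (hc : ∀ j, ∃ i, j ≤ u i) :
    ∃ l, GaloisConnection l u := by
  classical
  refine ⟨fun j => Nat.find (hc j), fun j i => ?_⟩
  rw [Nat.find_le_iff]
  exact ⟨fun ⟨m, hm, h⟩ => h.trans (hu hm), fun h => ⟨i, le_rfl, h⟩⟩

/-- Every frieze of finite type is the frieze of a Galois connection. -/
theorem IsFrieze.exists_eq_galoisFrieze {D : Set (ℤ × ℤ)} {n m : ℕ} (h : IsFrieze D)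
    (ht : HasType D n m) : ∃ u l, GaloisConnection l u ∧ D = galoisFrieze u l := by
  choose u hu using h.exists_assigns
  have hmono : Monotone u := fun i i' hi => h.assigns_mono (hu i) (hu i') hi
  have hodd : ∀ {i k : ℕ}, (-(2 * (k : ℤ) + 1), 2 * (i : ℤ) + 1) ∈ D → u i = k := fun hD =>
    h.assigns_unique (hu _) (h.assigns_of_odd hD)
  have heven : ∀ {i k : ℕ}, (-(2 * (k : ℤ) + 2), 2 * (i : ℤ) + 2) ∈ D → u i = k := fun hD =>
    h.assigns_unique (hu _) (h.assigns_of_even hD)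
  -- Finite type enters here: `k` is taken with `n + k` odd and `k > 2j`, so `[-(m+k), n+k]` is an
  -- odd transversal whose lower index is at least `j`.
  have hcof : ∀ j, ∃ i, j ≤ u i := by
    intro j
    obtain ⟨k, i, hk, hi, hj⟩ : ∃ k i : ℕ, 1 ≤ k ∧ n + k = 2 * i + 1 ∧ 2 * j < k := by
      rcases Nat.even_or_odd' n with ⟨c, rfl | rfl⟩
      · exact ⟨2 * j + 1, c + j, by omega, by omega, by omega⟩
      · exact ⟨2 * j + 2, c + j + 1, by omega, by omega, by omega⟩
    have hD := ht k hk
    rw [show (n : ℤ) + k = 2 * i + 1 by omega] at hD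
    obtain ⟨t, htt⟩ := h.odd_transversal hD (by omega)
    rw [htt] at hD
    exact ⟨i, by rw [hodd hD]; omega⟩
  obtain ⟨l, gc⟩ := exists_galoisConnection hmono hcof
  refine ⟨u, l, gc, h.eq_of_subset (isFrieze_galoisFrieze gc) ?_⟩
  rintro ⟨a, b⟩ hab
  have hseg := h.segment hab
  obtain ⟨i, rfl | rfl | rfl | rfl⟩ := exists_nat_of_ne_zero hseg.2.2
  · rcases lt_or_gt_of_ne hseg.2.1 with ha | ha
    · obtain ⟨j, rfl⟩ := h.odd_transversal hab ha
      have hij := hodd hab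
      refine odd_mem_galoisFrieze.2 ⟨hij, ?_⟩
      have h₁ := gc j i
      rcases Nat.eq_zero_or_pos i with rfl | hpos
      · omega
      · have h₂ := gc j (i - 1)
        -- Otherwise `u (i - 1) = j`, and the pair covering `i - 1` would contain a second segment
        -- starting in `-(2j+1)`.
        have h₃ : ¬ j ≤ u (i - 1) := by
          intro hle
          have hle' := hmono (Nat.sub_le i 1)
          obtain ⟨k₂, k₃, hD, -, hk, -⟩ := hu (i - 1)
          rw [show u (i - 1) = j by omega] at hD
          have := h.right_unique hD hab
          omega
        omega
    · obtain ⟨k, rfl, hk⟩ := h.cup hab ha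
      obtain rfl : i = k + 1 := by omega
      rw [hk] at hab ⊢
      refine cup_mem_galoisFrieze ?_
      obtain ⟨k₂, k₃, hD, hD', hle, hle'⟩ := hu k
      -- The even transversal of the pair covering `k` cannot end in `2k+2`, where the cup begins;
      -- hence the pair also covers `k + 1`.
      have hne : k ≠ k₂ + k₃ := by
        rintro rfl
        refine h.not_chain hD' (c := 2 * (k₂ + k₃ : ℕ) + 3) ?_
        convert hab using 2
        push_cast
        ring
      exact h.assigns_unique ⟨k₂, k₃, hD, hD', by omega, by omega⟩ (hu (k + 1))
  · rcases lt_or_gt_of_ne hseg.2.1 with ha | ha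
    · obtain ⟨j, rfl⟩ := h.even_transversal hab ha
      have hij := heven hab
      refine even_mem_galoisFrieze.2 ⟨hij, ?_⟩
      have h₁ := gc (j + 1) i
      have h₂ := gc (j + 1) (i + 1)
      have h₃ : j + 1 ≤ u (i + 1) := by
        by_contra hle
        have hle' := hmono (show i ≤ i + 1 by omega)
        obtain ⟨k₂, k₃, -, hD, -, hk⟩ := hu (i + 1)
        rw [show u (i + 1) = j by omega] at hD
        have := h.right_unique hD hab
        omega
      omega
    · obtain ⟨k, -, hk⟩ := h.cup hab ha
      omega
  · obtain ⟨k, rfl, hk⟩ := h.cap hab (by omega)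
    obtain rfl : i = k := by omega
    refine cap_mem_galoisFrieze ?_
    have h₁ := gc i (l i)
    have h₂ := gc (i + 1) (l i)
    have h₃ := gc.monotone_l (show i ≤ i + 1 by omega)
    have h₄ : u (l i) ≠ i := by
      intro he
      obtain ⟨k₂, k₃, hD, -⟩ := hu (l i)
      rw [he] at hD
      exact h.not_chain hab hD
    omega
  · obtain ⟨k, -, hk⟩ := h.cap hab (by omega)
    omega

/-- The fibre of `u` through `i` is the interval from `l (u i)` to `l (u i + 1) - 1`, and the pair
covers exactly it. No subtraction truncates, since `l (u i) ≤ i < l (u i + 1)`. -/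
theorem assigns_galoisFrieze (gc : GaloisConnection l u) (i : ℕ) :
    Assigns (galoisFrieze u l) i (u i) := by
  have h₁ := gc (u i) i
  have h₂ := gc (u i + 1) i
  have h₃ := gc.u_l_u_eq_u i
  refine ⟨l (u i), l (u i + 1) - 1 - l (u i), odd_mem_galoisFrieze.2 ⟨h₃, rfl⟩, ?_, by omega,
    by omega⟩
  have := even_mem_galoisFrieze (u := u) (l := l) (i := l (u i + 1) - 1) (j := u i)
  rw [show (2 : ℤ) * (l (u i) : ℕ) + 2 * (l (u i + 1) - 1 - l (u i) : ℕ) + 2 =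
    2 * (l (u i + 1) - 1 : ℕ) + 2 by omega, this]
  have h₄ := gc (u i + 1) (l (u i + 1) - 1)
  have h₅ := gc.monotone_u (show i ≤ l (u i + 1) - 1 by omega)
  omega

/-- The segments with odd `k` determine `u` and `l` from `n` and `m` on; each even one combines the
values of `u` and `l` at two successive `e`. -/
theorem hasType_galoisFrieze {n m : ℕ} : HasType (galoisFrieze u l) (2 * n) (2 * m) ↔
    ∀ e, u (n + e) = m + e ∧ l (m + e) = n + e := by
  constructor
  · intro h e
    have := h (2 * e + 1) (by omega)
    refine odd_mem_galoisFrieze.1 ?_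
    convert this using 2 <;> push_cast <;> ring
  · intro h k hk
    rcases Nat.even_or_odd' k with ⟨c, rfl | rfl⟩
    · obtain ⟨c, rfl⟩ : ∃ d, c = d + 1 := ⟨c - 1, by omega⟩
      convert even_mem_galoisFrieze.2 ⟨(h c).1, (h (c + 1)).2⟩ using 2 <;> push_cast <;> ring
    · convert odd_mem_galoisFrieze.2 (h c) using 2 <;> push_cast <;> ring

end galoisFrieze

/-! ## Composition of friezes of Galois connections -/

section friezeComp

/-- The pair of regions on the two sides of the strand of the frieze `galoisFrieze u l` that ends
in a given nonzero integer. -/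
def regions (u l : ℕ → ℕ) (a : ℤ) : ℕ × ℕ :=
  if 0 < a then (u ((a.natAbs - 1) / 2), a.natAbs / 2) else ((a.natAbs - 1) / 2, l (a.natAbs / 2))

variable {u l : ℕ → ℕ}

theorem regions_odd (i : ℕ) : regions u l (2 * (i : ℤ) + 1) = (u i, i) := by
  rw [regions, if_pos (by omega), show (2 * (i : ℤ) + 1).natAbs = 2 * i + 1 by omega,
    show (2 * i + 1 - 1) / 2 = i by omega, show (2 * i + 1) / 2 = i by omega]

theorem regions_even (i : ℕ) : regions u l (2 * (i : ℤ) + 2) = (u i, i + 1) := by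
  rw [regions, if_pos (by omega), show (2 * (i : ℤ) + 2).natAbs = 2 * i + 2 by omega,
    show (2 * i + 2 - 1) / 2 = i by omega, show (2 * i + 2) / 2 = i + 1 by omega]

theorem regions_neg_odd (j : ℕ) : regions u l (-(2 * (j : ℤ) + 1)) = (j, l j) := by
  rw [regions, if_neg (by omega), show (-(2 * (j : ℤ) + 1)).natAbs = 2 * j + 1 by omega,
    show (2 * j + 1 - 1) / 2 = j by omega, show (2 * j + 1) / 2 = j by omega]

theorem regions_neg_even (j : ℕ) : regions u l (-(2 * (j : ℤ) + 2)) = (j, l (j + 1)) := by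
  rw [regions, if_neg (by omega), show (-(2 * (j : ℤ) + 2)).natAbs = 2 * j + 2 by omega,
    show (2 * j + 2 - 1) / 2 = j by omega, show (2 * j + 2) / 2 = j + 1 by omega]

theorem regions_eq {a b : ℤ} (h : (a, b) ∈ galoisFrieze u l) :
    regions u l a = regions u l b := by
  rw [mk_mem_galoisFrieze] at h
  rcases h with ⟨k, ⟨rfl, rfl⟩, h⟩ | ⟨k, ⟨rfl, rfl⟩, h⟩ | ⟨k, ⟨rfl, rfl⟩, h⟩ | ⟨k, ⟨rfl, rfl⟩, h⟩
  · rw [show 2 * (k : ℤ) + 3 = 2 * (k + 1 : ℕ) + 1 by push_cast; ring, regions_odd,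
      regions_even, h]
  · rw [regions_neg_odd, regions_neg_even, h]
  · rw [regions_odd, regions_neg_odd, h]
  · rw [regions_even, regions_neg_even, h]

/-- Of the sixteen combinations of end points, four are the kinds of segments, two contradict the
adjunction, and the rest fail by arithmetic. -/
theorem mem_galoisFrieze_of_regions_eq (gc : GaloisConnection l u) {a b : ℤ} (hab : a < b)
    (ha : a ≠ 0) (hb : b ≠ 0) (h : regions u l a = regions u l b) :
    (a, b) ∈ galoisFrieze u l := by
  obtain ⟨i, rfl | rfl | rfl | rfl⟩ := exists_nat_of_ne_zero ha <;>
  obtain ⟨k, rfl | rfl | rfl | rfl⟩ := exists_nat_of_ne_zero hb <;>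
  simp only [regions_odd, regions_even, regions_neg_odd, regions_neg_even, Prod.mk.injEq] at h
  case inr.inl.inl =>
    obtain rfl : k = i + 1 := by omega
    convert cup_mem_galoisFrieze h.1 using 2
    push_cast
    ring
  case inr.inr.inl.inl => exact odd_mem_galoisFrieze.2 ⟨h.1.symm, h.2⟩
  case inr.inr.inl.inr.inl =>
    have := gc i k
    omega
  case inr.inr.inr.inl =>
    have := gc (i + 1) k
    omega
  case inr.inr.inr.inr.inl => exact even_mem_galoisFrieze.2 ⟨h.1.symm, h.2⟩
  case inr.inr.inr.inr.inr.inl =>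
    obtain rfl : i = k := h.1
    exact cap_mem_galoisFrieze h.2.symm
  all_goals omega

-- Region labels as an invariant of the stacked diagram

variable {u₁ l₁ u₂ l₂ : ℕ → ℕ}

/-- The pair of regions on the two sides of the strand through a given point of the diagram in
which `galoisFrieze u₁ l₁` is drawn above `galoisFrieze u₂ l₂`. -/
def diagramRegions (u₁ l₁ u₂ l₂ : ℕ → ℕ) : Level × ℕ → ℕ × ℕ
  | (.top, a) => (u₂ (u₁ ((a - 1) / 2)), a / 2)
  | (.middle, a) => (u₂ ((a - 1) / 2), l₁ (a / 2))
  | (.bottom, a) => ((a - 1) / 2, l₁ (l₂ (a / 2)))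

theorem diagramRegions_upper (a : ℤ) : diagramRegions u₁ l₁ u₂ l₂ (place .top .middle a) =
    (u₂ (regions u₁ l₁ a).1, (regions u₁ l₁ a).2) := by
  unfold place regions
  split_ifs <;> rfl

theorem diagramRegions_lower (a : ℤ) : diagramRegions u₁ l₁ u₂ l₂ (place .middle .bottom a) =
    ((regions u₂ l₂ a).1, l₁ (regions u₂ l₂ a).2) := by
  unfold place regions
  split_ifs <;> rfl

theorem diagramRegions_outer (a : ℤ) : diagramRegions u₁ l₁ u₂ l₂ (place .top .bottom a) =
    regions (u₂ ∘ u₁) (l₁ ∘ l₂) a := by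
  unfold place regions
  split_ifs <;> rfl

/-- First labels of the upper frieze are carried down by `u₂`, second labels of the lower one are
carried up by `l₁`; the two labellings agree on the middle line, so `regions_eq` applies to every
segment. -/
theorem diagramRegions_eq {x y : Level × ℕ}
    (h : Relation.EqvGen (Joined (galoisFrieze u₂ l₂) (galoisFrieze u₁ l₁)) x y) :
    diagramRegions u₁ l₁ u₂ l₂ x = diagramRegions u₁ l₁ u₂ l₂ y := by
  induction h with
  | rel x y h =>
    cases h with
    | upper h => rw [diagramRegions_upper, diagramRegions_upper, regions_eq h]
    | lower h => rw [diagramRegions_lower, diagramRegions_lower, regions_eq h]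
  | refl => rfl
  | symm _ _ _ ih => exact ih.symm
  | trans _ _ _ _ _ ih₁ ih₂ => exact ih₁.trans ih₂

-- Explicit paths in the stacked diagram

theorem place_odd (v w : Level) (i : ℕ) : place v w (2 * (i : ℤ) + 1) = (v, 2 * i + 1) := by
  rw [place, if_pos (by omega), show (2 * (i : ℤ) + 1).natAbs = 2 * i + 1 by omega]

theorem place_even (v w : Level) (i : ℕ) : place v w (2 * (i : ℤ) + 2) = (v, 2 * i + 2) := by
  rw [place, if_pos (by omega), show (2 * (i : ℤ) + 2).natAbs = 2 * i + 2 by omega]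

theorem place_succ_odd (v w : Level) (i : ℕ) :
    place v w (2 * (i : ℤ) + 3) = (v, 2 * (i + 1) + 1) := by
  rw [place, if_pos (by omega), show (2 * (i : ℤ) + 3).natAbs = 2 * (i + 1) + 1 by omega]

theorem place_neg_odd (v w : Level) (i : ℕ) :
    place v w (-(2 * (i : ℤ) + 1)) = (w, 2 * i + 1) := by
  rw [place, if_neg (by omega), show (-(2 * (i : ℤ) + 1)).natAbs = 2 * i + 1 by omega]

theorem place_neg_even (v w : Level) (i : ℕ) :
    place v w (-(2 * (i : ℤ) + 2)) = (w, 2 * i + 2) := by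
  rw [place, if_neg (by omega), show (-(2 * (i : ℤ) + 2)).natAbs = 2 * i + 2 by omega]

/-- Connectedness of points in the diagram in which `galoisFrieze u₁ l₁` is drawn above
`galoisFrieze u₂ l₂`. -/
abbrev Conn (u₁ l₁ u₂ l₂ : ℕ → ℕ) : Level × ℕ → Level × ℕ → Prop :=
  Relation.EqvGen (Joined (galoisFrieze u₂ l₂) (galoisFrieze u₁ l₁))

namespace Conn

theorem symm {x y : Level × ℕ} (h : Conn u₁ l₁ u₂ l₂ x y) : Conn u₁ l₁ u₂ l₂ y x :=
  Relation.EqvGen.symm _ _ h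

theorem trans {x y z : Level × ℕ} (h : Conn u₁ l₁ u₂ l₂ x y) (h' : Conn u₁ l₁ u₂ l₂ y z) :
    Conn u₁ l₁ u₂ l₂ x z :=
  Relation.EqvGen.trans _ _ _ h h'

theorem upper {a b : ℤ} (h : (a, b) ∈ galoisFrieze u₁ l₁) :
    Conn u₁ l₁ u₂ l₂ (place .top .middle a) (place .top .middle b) :=
  .rel _ _ (.upper h)

theorem lower {a b : ℤ} (h : (a, b) ∈ galoisFrieze u₂ l₂) :
    Conn u₁ l₁ u₂ l₂ (place .middle .bottom a) (place .middle .bottom b) :=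
  .rel _ _ (.lower h)

theorem upper_cup {k : ℕ} (h : u₁ k = u₁ (k + 1)) :
    Conn u₁ l₁ u₂ l₂ (.top, 2 * k + 2) (.top, 2 * (k + 1) + 1) := by
  simpa only [place_even, place_succ_odd] using upper (cup_mem_galoisFrieze h)

theorem lower_cup {k : ℕ} (h : u₂ k = u₂ (k + 1)) :
    Conn u₁ l₁ u₂ l₂ (.middle, 2 * k + 2) (.middle, 2 * (k + 1) + 1) := by
  simpa only [place_even, place_succ_odd] using lower (cup_mem_galoisFrieze h)

theorem upper_cap {j : ℕ} (h : l₁ j = l₁ (j + 1)) :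
    Conn u₁ l₁ u₂ l₂ (.middle, 2 * j + 1) (.middle, 2 * j + 2) := by
  simpa only [place_neg_even, place_neg_odd] using (upper (cap_mem_galoisFrieze h)).symm

theorem lower_cap {j : ℕ} (h : l₂ j = l₂ (j + 1)) :
    Conn u₁ l₁ u₂ l₂ (.bottom, 2 * j + 1) (.bottom, 2 * j + 2) := by
  simpa only [place_neg_even, place_neg_odd] using (lower (cap_mem_galoisFrieze h)).symm

theorem upper_odd {i j : ℕ} (h : u₁ i = j) (h' : l₁ j = i) :
    Conn u₁ l₁ u₂ l₂ (.top, 2 * i + 1) (.middle, 2 * j + 1) := by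
  simpa only [place_odd, place_neg_odd] using (upper (odd_mem_galoisFrieze.2 ⟨h, h'⟩)).symm

theorem lower_odd {i j : ℕ} (h : u₂ i = j) (h' : l₂ j = i) :
    Conn u₁ l₁ u₂ l₂ (.middle, 2 * i + 1) (.bottom, 2 * j + 1) := by
  simpa only [place_odd, place_neg_odd] using (lower (odd_mem_galoisFrieze.2 ⟨h, h'⟩)).symm

theorem upper_even {i j : ℕ} (h : u₁ i = j) (h' : l₁ (j + 1) = i + 1) :
    Conn u₁ l₁ u₂ l₂ (.top, 2 * i + 2) (.middle, 2 * j + 2) := by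
  simpa only [place_even, place_neg_even] using (upper (even_mem_galoisFrieze.2 ⟨h, h'⟩)).symm

theorem lower_even {i j : ℕ} (h : u₂ i = j) (h' : l₂ (j + 1) = i + 1) :
    Conn u₁ l₁ u₂ l₂ (.middle, 2 * i + 2) (.bottom, 2 * j + 2) := by
  simpa only [place_even, place_neg_even] using (lower (even_mem_galoisFrieze.2 ⟨h, h'⟩)).symm

/-- Caps of the upper frieze and cups of the lower frieze alternate along the middle line. -/
theorem middle (hl : Monotone l₁) (hu : Monotone u₂) {p q : ℕ} (hpq : p ≤ q)
    (h₁ : l₁ p = l₁ q) (h₂ : u₂ p = u₂ q) :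
    Conn u₁ l₁ u₂ l₂ (.middle, 2 * p + 1) (.middle, 2 * q + 1) := by
  induction q, hpq using Nat.le_induction with
  | base => exact Relation.EqvGen.refl _
  | succ q hpq ih =>
    have := hl hpq
    have := hl (show q ≤ q + 1 by omega)
    have := hu hpq
    have := hu (show q ≤ q + 1 by omega)
    exact ((ih (by omega) (by omega)).trans (upper_cap (by omega))).trans (lower_cup (by omega))

theorem middle_even (hl : Monotone l₁) (hu : Monotone u₂) {p q : ℕ} (hpq : p ≤ q)
    (h₁ : l₁ (p + 1) = l₁ (q + 1)) (h₂ : u₂ p = u₂ q) :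
    Conn u₁ l₁ u₂ l₂ (.middle, 2 * p + 2) (.middle, 2 * q + 2) := by
  rcases hpq.eq_or_lt with rfl | hlt
  · exact Relation.EqvGen.refl _
  · have := hl (show p + 1 ≤ q by omega)
    have := hl (show q ≤ q + 1 by omega)
    have := hu (show p ≤ p + 1 by omega)
    have := hu (show p + 1 ≤ q by omega)
    exact ((lower_cup (by omega)).trans (middle hl hu hlt (by omega) (by omega))).trans
      (upper_cap (by omega))

end Conn

/-- The points joined by the frieze of a composite Galois connection are connected in the diagram
of the two friezes. -/
theorem conn_of_mem_galoisFrieze_comp (gc₁ : GaloisConnection l₁ u₁)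
    (gc₂ : GaloisConnection l₂ u₂) {a b : ℤ} (h : (a, b) ∈ galoisFrieze (u₂ ∘ u₁) (l₁ ∘ l₂)) :
    Conn u₁ l₁ u₂ l₂ (place .top .bottom a) (place .top .bottom b) := by
  have hl := gc₁.monotone_l
  have hu := gc₂.monotone_u
  rw [mk_mem_galoisFrieze] at h
  simp only [Function.comp_apply] at h
  rcases h with ⟨k, ⟨rfl, rfl⟩, h⟩ | ⟨j, ⟨rfl, rfl⟩, h⟩ | ⟨i, ⟨rfl, rfl⟩, h⟩ | ⟨i, ⟨rfl, rfl⟩, h⟩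
  · rw [place_even, place_succ_odd]
    by_cases hk : u₁ k = u₁ (k + 1)
    · exact .upper_cup hk
    -- Here `u₁` jumps at `k` but `u₂` is constant across the jump: the path goes down from `2k+2`,
    -- along the middle line, and up to `2k+3`.
    · have hlt : u₁ k + 1 ≤ u₁ (k + 1) := by
        have := gc₁.monotone_u (show k ≤ k + 1 by omega)
        omega
      have := gc₁ (u₁ k + 1) (k + 1)
      have := gc₁ (u₁ k + 1) k
      have := gc₁ (u₁ (k + 1)) (k + 1)
      have := gc₁ (u₁ (k + 1)) k
      have := hu hlt
      have := hu (show u₁ k ≤ u₁ k + 1 by omega)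
      exact ((Conn.upper_even rfl (by omega)).trans (.lower_cup (by omega))).trans
        ((Conn.middle hl hu hlt (by omega) (by omega)).trans
          (Conn.upper_odd rfl (by omega)).symm)
  · rw [place_neg_even, place_neg_odd]
    refine Conn.symm ?_
    by_cases hj : l₂ j = l₂ (j + 1)
    · exact .lower_cap hj
    -- Dually, `l₂` jumps at `j` and `l₁` is constant across the jump: the path goes up, along the
    -- middle line, and down again.
    · obtain ⟨q, hq⟩ : ∃ q, l₂ (j + 1) = q + 1 := by
        have := gc₂.monotone_l (show j ≤ j + 1 by omega)
        exact ⟨l₂ (j + 1) - 1, by omega⟩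
      have hlt : l₂ j ≤ q := by
        have := gc₂.monotone_l (show j ≤ j + 1 by omega)
        omega
      have := gc₂ j (l₂ j)
      have := gc₂ (j + 1) (l₂ j)
      have := gc₂ j q
      have := gc₂ (j + 1) q
      have := hl hlt
      have := hl (show q ≤ q + 1 by omega)
      rw [hq] at h
      exact ((Conn.lower_odd (i := l₂ j) (by omega) rfl).symm.trans
        (Conn.middle hl hu hlt (by omega) (by omega))).trans
        ((Conn.upper_cap (by omega)).trans (.lower_even (by omega) hq))
  · rw [place_odd, place_neg_odd]
    -- The two odd transversals meet the middle line at these two indices, on which `u₂` agrees; the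
    -- alternating path bridges the gap.
    have hle : l₂ (u₂ (u₁ i)) ≤ u₁ i := gc₂.l_u_le _
    have := hl hle
    have := gc₁ (u₁ i) i
    have h₂ := gc₂.u_l_u_eq_u (u₁ i)
    exact ((Conn.upper_odd rfl (by omega)).trans
      ((Conn.middle hl hu hle (by omega) h₂).symm.trans (.lower_odd h₂ rfl))).symm
  · rw [place_even, place_neg_even]
    have := gc₂ (u₂ (u₁ i) + 1) (u₁ i)
    obtain ⟨q, hq⟩ : ∃ q, l₂ (u₂ (u₁ i) + 1) = q + 1 :=
      ⟨l₂ (u₂ (u₁ i) + 1) - 1, by omega⟩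
    have hle : u₁ i ≤ q := by omega
    have := gc₂ (u₂ (u₁ i) + 1) q
    have := hu hle
    have := hl (show u₁ i + 1 ≤ q + 1 by omega)
    have := gc₁ (u₁ i + 1) i
    rw [hq] at h
    exact ((Conn.upper_even rfl (by omega)).trans
      ((Conn.middle_even hl hu hle (by omega) (by omega)).trans
        (.lower_even (by omega) hq))).symm

theorem friezeComp_galoisFrieze (gc₁ : GaloisConnection l₁ u₁) (gc₂ : GaloisConnection l₂ u₂) :
    friezeComp (galoisFrieze u₂ l₂) (galoisFrieze u₁ l₁) =
      galoisFrieze (u₂ ∘ u₁) (l₁ ∘ l₂) := by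
  have gc := gc₂.compose gc₁
  ext ⟨a, b⟩
  constructor
  · rintro ⟨hab, ha, hb, h⟩
    refine mem_galoisFrieze_of_regions_eq gc hab ha hb ?_
    rw [← diagramRegions_outer, ← diagramRegions_outer]
    exact diagramRegions_eq h
  · intro h
    obtain ⟨hab, ha, hb⟩ := (isFrieze_galoisFrieze gc).segment h
    exact ⟨hab, ha, hb, conn_of_mem_galoisFrieze_comp gc₁ gc₂ h⟩

end friezeComp

-- Friezes of finite type form a category

theorem HasType.comp {D₁ D₂ : Set (ℤ × ℤ)} {n m l : ℕ} (h₁ : HasType D₁ n m)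
    (h₂ : HasType D₂ m l) : HasType (friezeComp D₂ D₁) n l := by
  intro k hk
  refine ⟨by change -((l : ℤ) + k) < n + k; omega, by change -((l : ℤ) + k) ≠ 0; omega,
    by change (n : ℤ) + k ≠ 0; omega, ?_⟩
  have e₁ := Joined.upper (D₂ := D₂) (h₁ k hk)
  have e₂ := Joined.lower (D₁ := D₁) (h₂ k hk)
  have hpos : ∀ x : ℕ, 0 < x + k := fun x => by omega
  simp only [place, ← Nat.cast_add, Int.neg_pos, Int.natAbs_neg, Int.natAbs_natCast, Nat.cast_pos,
    hpos, if_true, not_lt_of_ge (Int.natCast_nonneg _), if_false] at e₁ e₂ ⊢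
  exact (Relation.EqvGen.rel _ _ e₂).trans _ _ _ (Relation.EqvGen.rel _ _ e₁)

theorem Frieze.exists_eq_galoisFrieze {n m : ℕ} (D : Frieze n m) :
    ∃ u l, GaloisConnection l u ∧ D.1 = galoisFrieze u l :=
  D.2.1.exists_eq_galoisFrieze D.2.2

theorem friezesCompose : FriezesCompose where
  unit n := by
    refine ⟨unitFrieze_eq ▸ isFrieze_galoisFrieze GaloisConnection.id, fun k hk => ?_⟩
    exact ⟨n + k - 1, by rw [Prod.mk.injEq]; omega⟩
  comp D₁ D₂ := by
    refine ⟨?_, D₁.2.2.comp D₂.2.2⟩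
    obtain ⟨u₁, l₁, gc₁, h₁⟩ := D₁.exists_eq_galoisFrieze
    obtain ⟨u₂, l₂, gc₂, h₂⟩ := D₂.exists_eq_galoisFrieze
    rw [h₁, h₂, friezeComp_galoisFrieze gc₁ gc₂]
    exact isFrieze_galoisFrieze (gc₂.compose gc₁)
  comp_unit D := by
    obtain ⟨u, l, gc, h⟩ := D.exists_eq_galoisFrieze
    rw [h, unitFrieze_eq, friezeComp_galoisFrieze .id gc]
    rfl
  unit_comp D := by
    obtain ⟨u, l, gc, h⟩ := D.exists_eq_galoisFrieze
    rw [h, unitFrieze_eq, friezeComp_galoisFrieze gc .id]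
    rfl
  assoc D₁ D₂ D₃ := by
    obtain ⟨u₁, l₁, gc₁, h₁⟩ := D₁.exists_eq_galoisFrieze
    obtain ⟨u₂, l₂, gc₂, h₂⟩ := D₂.exists_eq_galoisFrieze
    obtain ⟨u₃, l₃, gc₃, h₃⟩ := D₃.exists_eq_galoisFrieze
    rw [h₁, h₂, h₃, friezeComp_galoisFrieze gc₁ gc₂, friezeComp_galoisFrieze gc₂ gc₃,
      friezeComp_galoisFrieze (gc₂.compose gc₁) gc₃,
      friezeComp_galoisFrieze gc₁ (gc₃.compose gc₂)]
    rfl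

/-! ## The isomorphism of the category of friezes with the simplicial category -/

/-- The order-preserving function on `ℕ` assigned to a frieze of finite type. -/
noncomputable def Frieze.upper {n m : ℕ} (D : Frieze n m) : ℕ → ℕ :=
  D.exists_eq_galoisFrieze.choose

theorem Frieze.upper_spec {n m : ℕ} (D : Frieze n m) :
    ∃ l, GaloisConnection l D.upper ∧ D.1 = galoisFrieze D.upper l :=
  D.exists_eq_galoisFrieze.choose_spec

theorem Frieze.upper_eq {n m : ℕ} (D : Frieze n m) {u l : ℕ → ℕ} (gc : GaloisConnection l u)
    (h : D.1 = galoisFrieze u l) : D.upper = u := by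
  obtain ⟨l', gc', h'⟩ := D.upper_spec
  funext i
  exact D.2.1.assigns_unique (h' ▸ assigns_galoisFrieze gc' i) (h ▸ assigns_galoisFrieze gc i)

theorem Frieze.assigns_upper {n m : ℕ} (D : Frieze n m) (i : ℕ) : Assigns D.1 i (D.upper i) := by
  obtain ⟨l, gc, h⟩ := D.upper_spec
  exact h ▸ assigns_galoisFrieze gc i

theorem Frieze.upper_monotone {n m : ℕ} (D : Frieze n m) : Monotone D.upper := by
  obtain ⟨l, gc, -⟩ := D.upper_spec
  exact gc.monotone_u

/-- An upper adjoint determines its lower adjoint, hence the whole frieze. -/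
theorem Frieze.ext_upper {n m : ℕ} {D D' : Frieze n m} (h : D.upper = D'.upper) : D = D' := by
  obtain ⟨l, gc, hD⟩ := D.upper_spec
  obtain ⟨l', gc', hD'⟩ := D'.upper_spec
  rw [← h] at gc' hD'
  obtain rfl : l = l' := funext fun j => gc.l_unique gc' fun _ => rfl
  exact Subtype.ext (hD.trans hD'.symm)

theorem Frieze.upper_add {n m : ℕ} (D : Frieze (2 * n) (2 * m)) (e : ℕ) :
    D.upper (n + e) = m + e := by
  obtain ⟨l, gc, h⟩ := D.upper_spec
  exact (hasType_galoisFrieze.1 (h ▸ D.2.2) e).1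

/-- The type gives `l m = n`, so `m ≤ u i` would mean `n ≤ i`. -/
theorem Frieze.upper_lt {n m : ℕ} (D : Frieze (2 * n) (2 * m)) {i : ℕ} (hi : i < n) :
    D.upper i < m := by
  obtain ⟨l, gc, h⟩ := D.upper_spec
  have h₁ := (hasType_galoisFrieze.1 (h ▸ D.2.2) 0).2
  have h₂ := gc m i
  simp only [add_zero] at h₁
  omega

/-- A frieze of type `(2(n+1), 2(m+1))` contains `[-2(m+1), 2(n+1)]` if and only if its function
maps `n` to `m`. -/
theorem Frieze.mem_iff_upper {n m : ℕ} (D : Frieze (2 * (n + 1)) (2 * (m + 1))) :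
    (-(2 * (m : ℤ) + 2), 2 * (n : ℤ) + 2) ∈ D.1 ↔ D.upper n = m := by
  obtain ⟨l, gc, h⟩ := D.upper_spec
  have := (hasType_galoisFrieze.1 (h ▸ D.2.2) 0).2
  rw [h, even_mem_galoisFrieze]
  exact and_iff_left this

/-- Every order-preserving function between finite ordinals is assigned to a frieze. -/
theorem Frieze.exists_upper_eq {n m : ℕ} (f : Fin n →o Fin m) :
    ∃ D : Frieze (2 * n) (2 * m), ∀ i : Fin n, D.upper i = f i := by
  set u : ℕ → ℕ := fun i => if h : i < n then f ⟨i, h⟩ else m + (i - n) with hu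
  have hlt : ∀ i (h : i < n), u i = f ⟨i, h⟩ := fun i h => dif_pos h
  have hge : ∀ e, u (n + e) = m + e := fun e => by
    rw [hu]
    simp
  have hmono : Monotone u := by
    intro i j hij
    by_cases hj : j < n
    · rw [hlt j hj, hlt i (by omega)]
      exact f.monotone hij
    · obtain ⟨e, rfl⟩ : ∃ e, j = n + e := ⟨j - n, by omega⟩
      rw [hge]
      by_cases hi : i < n
      · rw [hlt i hi]
        omega
      · obtain ⟨c, rfl⟩ : ∃ c, i = n + c := ⟨i - n, by omega⟩
        rw [hge]
        omega
  obtain ⟨l, gc⟩ := exists_galoisConnection hmono fun j => ⟨n + j, by rw [hge]; omega⟩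
  have ht : HasType (galoisFrieze u l) (2 * n) (2 * m) := by
    refine hasType_galoisFrieze.2 fun e => ⟨hge e, ?_⟩
    have h₁ := gc (m + e) (n + e)
    have h₂ := gc (m + e) (n + e - 1)
    rw [hge] at h₁
    -- At `e = 0`, minimality of `n` comes from the codomain of `f`, which bounds `u (n - 1)` by
    -- `m`; for later `e` the shift itself gives it.
    rcases e with _ | e
    · rcases n with _ | n
      · omega
      · have := hlt n (by omega)
        have := (f ⟨n, by omega⟩).2
        simp only [Nat.add_zero, Nat.add_sub_cancel] at h₁ h₂ ⊢
        omega
    · have h₃ := hge e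
      rw [show n + (e + 1) - 1 = n + e by omega, h₃] at h₂
      omega
  refine ⟨⟨galoisFrieze u l, isFrieze_galoisFrieze gc, ht⟩, fun i => ?_⟩
  exact (congrFun (Frieze.upper_eq _ gc rfl) i).trans (hlt i i.2)

/-- The functor from the category of friezes of even type to the simplicial category. -/
noncomputable def friezeToDelta (h : FriezesCompose) : DB h ⥤ Delta where
  obj X := ⟨X.n / 2⟩
  map {X Y} D := show Fin (X.n / 2) →o Fin (Y.n / 2) from
    { toFun := fun i => ⟨Frieze.upper (show Frieze X.n Y.n from D) i, by
        obtain ⟨n, hn⟩ := X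
        obtain ⟨m, hm⟩ := Y
        obtain ⟨n, rfl⟩ := hn.two_dvd
        obtain ⟨m, rfl⟩ := hm.two_dvd
        have hi := i.2
        simp only [Nat.mul_div_cancel_left _ two_pos] at hi ⊢
        exact Frieze.upper_lt _ hi⟩
      monotone' := fun _ _ hij => Frieze.upper_monotone _ hij }
  map_id X := OrderHom.ext _ _ (funext fun i => Fin.ext (congrFun
    (Frieze.upper_eq (n := X.n) (m := X.n) _ GaloisConnection.id unitFrieze_eq) i))
  map_comp {X Y Z} D₁ D₂ := by
    obtain ⟨l₁, gc₁, h₁⟩ := Frieze.upper_spec (show Frieze X.n Y.n from D₁)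
    obtain ⟨l₂, gc₂, h₂⟩ := Frieze.upper_spec (show Frieze Y.n Z.n from D₂)
    refine OrderHom.ext _ _ (funext fun i => Fin.ext (congrFun
      (Frieze.upper_eq (n := X.n) (m := Z.n) _ (gc₂.compose gc₁) ?_) i))
    rw [← friezeComp_galoisFrieze gc₁ gc₂, ← h₁, ← h₂]
    rfl

instance (h : FriezesCompose) : (friezeToDelta h).IsIso where
  faithful := ⟨by
    rintro ⟨n, hn⟩ ⟨m, hm⟩ D D' hD
    obtain ⟨n, rfl⟩ := hn.two_dvd
    obtain ⟨m, rfl⟩ := hm.two_dvd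
    refine Frieze.ext_upper (funext fun i => ?_)
    by_cases hi : i < n
    · exact congrArg Fin.val (DFunLike.congr_fun
        (F := Fin (2 * n / 2) →o Fin (2 * m / 2)) hD ⟨i, by omega⟩)
    · obtain ⟨e, rfl⟩ : ∃ e, i = n + e := ⟨i - n, by omega⟩
      rw [Frieze.upper_add, Frieze.upper_add]⟩
  full := ⟨by
    rintro ⟨n, hn⟩ ⟨m, hm⟩ f
    obtain ⟨n, rfl⟩ := hn.two_dvd
    obtain ⟨m, rfl⟩ := hm.two_dvd
    -- The ordinals have the form `2 * n / 2`, so they are generalised before being identified with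
    -- `n` and `m`.
    have key : ∀ {n' m' : ℕ} (_ : n' = n) (_ : m' = m) (f : Fin n' →o Fin m'),
        ∃ D : Frieze (2 * n) (2 * m), ∀ i : Fin n', D.upper i = f i := by
      rintro _ _ rfl rfl f
      exact Frieze.exists_upper_eq f
    obtain ⟨D, hD⟩ := key (Nat.mul_div_cancel_left n two_pos) (Nat.mul_div_cancel_left m two_pos) f
    exact ⟨D, OrderHom.ext _ _ (funext fun i => Fin.ext (hD i))⟩⟩
  bijective_obj := by
    constructor
    · rintro ⟨n, hn⟩ ⟨m, hm⟩ hnm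
      have : n / 2 = m / 2 := congrArg Delta.n hnm
      obtain rfl : n = m := by
        rw [← Nat.div_mul_cancel hn.two_dvd, this, Nat.div_mul_cancel hm.two_dvd]
      rfl
    · rintro ⟨n⟩
      exact ⟨⟨2 * n, even_two_mul n⟩, congrArg Delta.mk (Nat.mul_div_cancel_left n two_pos)⟩

/-! ## Friezes of odd type -/

/-- The functor `shift` with values in its image. -/
def shiftToLast (h : FriezesCompose) : DA h ⥤ (DBLast h).Cat where
  obj X := ⟨(shift h).obj X, Nat.succ_pos _⟩
  map {X Y} D := ⟨(shift h).map D, Nat.succ_pos _, Nat.succ_pos _, by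
    have := (show Frieze X.n Y.n from D).2.2 1 le_rfl
    change (-((Y.n + 1 : ℕ) : ℤ), ((X.n + 1 : ℕ) : ℤ)) ∈ _
    push_cast
    exact this⟩

instance (h : FriezesCompose) : (shiftToLast h).IsIso where
  faithful := ⟨by
    intro X Y D D' hD
    exact Subtype.ext (congrArg
      (fun E : (shiftToLast h).obj X ⟶ (shiftToLast h).obj Y => FriezeCat.segs E.1) hD)⟩
  full := ⟨by
    rintro X Y ⟨D, hX, hY, hD⟩
    have hD' := (show Frieze (X.n + 1) (Y.n + 1) from D).2
    refine ⟨(⟨FriezeCat.segs D, hD'.1, fun k hk => ?_⟩ : Frieze X.n Y.n), rfl⟩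
    change (-((Y.n + 1 : ℕ) : ℤ), ((X.n + 1 : ℕ) : ℤ)) ∈ _ at hD
    -- The type in `D_B` supplies the segments with `k ≥ 2`; the one with `k = 1` is the extra
    -- segment required of arrows in `DBLast`.
    rcases hk.eq_or_lt with rfl | hk
    · push_cast at hD ⊢
      exact hD
    · have hk' := hD'.2 (k - 1) (by omega)
      rwa [show ((X.n + 1 : ℕ) : ℤ) + (k - 1 : ℕ) = X.n + k by omega,
        show ((Y.n + 1 : ℕ) : ℤ) + (k - 1 : ℕ) = Y.n + k by omega] at hk'⟩
  bijective_obj := by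
    constructor
    · rintro ⟨n, hn⟩ ⟨m, hm⟩ hnm
      have : n + 1 = m + 1 := congrArg (fun X : (DBLast h).Cat => X.val.n) hnm
      obtain rfl : n = m := Nat.succ.inj this
      rfl
    · rintro ⟨⟨_ | n, hn⟩, hpos⟩
      · exact absurd hpos (lt_irrefl _)
      · exact ⟨⟨n, by rwa [Nat.even_add_one, Nat.not_even_iff_odd] at hn⟩, rfl⟩

/-- This matches the two subcategories under `friezeToDelta`, so the isomorphism for odd types is a
restriction of the one for even types. -/
theorem preservesLast_iff (h : FriezesCompose) {X Y : DB h} (hX : 0 < X.n) (hY : 0 < Y.n)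
    (D : X ⟶ Y) : Delta.PreservesLast ((friezeToDelta h).map D) ↔
      (-(Y.n : ℤ), (X.n : ℤ)) ∈ FriezeCat.segs D := by
  obtain ⟨n, hn⟩ := X
  obtain ⟨m, hm⟩ := Y
  obtain ⟨n, rfl⟩ := hn.two_dvd
  obtain ⟨m, rfl⟩ := hm.two_dvd
  obtain ⟨n, rfl⟩ : ∃ k, n = k + 1 := ⟨n - 1, by simp only at hX; omega⟩
  obtain ⟨m, rfl⟩ : ∃ k, m = k + 1 := ⟨m - 1, by simp only at hY; omega⟩
  have key := Frieze.mem_iff_upper (show Frieze (2 * (n + 1)) (2 * (m + 1)) from D)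
  rw [show (2 * (m : ℤ) + 2) = ((2 * (m + 1) : ℕ) : ℤ) by push_cast; ring,
    show (2 * (n : ℤ) + 2) = ((2 * (n + 1) : ℕ) : ℤ) by push_cast; ring] at key
  refine Iff.trans ?_ key.symm
  have hn' : 2 * (n + 1) / 2 - 1 = n := by omega
  have hm' : 2 * (m + 1) / 2 - 1 = m := by omega
  have hval : ∀ (hp : 2 * (n + 1) / 2 - 1 < 2 * (n + 1) / 2),
      (Delta.fn ((friezeToDelta h).map D) ⟨2 * (n + 1) / 2 - 1, hp⟩ : ℕ) =
        Frieze.upper (show Frieze (2 * (n + 1)) (2 * (m + 1)) from D) n := fun hp =>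
    congrArg (Frieze.upper (show Frieze (2 * (n + 1)) (2 * (m + 1)) from D)) hn'
  constructor
  · rintro ⟨hp, hq, hf⟩
    rw [← hval (Nat.sub_lt hp one_pos)]
    exact (congrArg Fin.val hf).trans hm'
  · intro hf
    have hp : 0 < 2 * (n + 1) / 2 := by omega
    have hq : 0 < 2 * (m + 1) / 2 := by omega
    exact ⟨hp, hq, Fin.ext ((hval (Nat.sub_lt hp one_pos)).trans (hf.trans hm'.symm))⟩

/-- The functor from the category of friezes of odd type to the category of
last-element-preserving functions. -/
noncomputable def friezeToDeltaLast (h : FriezesCompose) : DA h ⥤ deltaLast.Cat where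
  obj X := ⟨(shift h ⋙ friezeToDelta h).obj X, by
    obtain ⟨n, k, rfl⟩ := X
    change 0 < (2 * k + 1 + 1) / 2
    omega⟩
  map {X Y} D := ⟨(shift h ⋙ friezeToDelta h).map D,
    (preservesLast_iff h (Nat.succ_pos _) (Nat.succ_pos _) _).2
      ((shiftToLast h).map D).2.2.2⟩
  map_id X := Subtype.ext ((shift h ⋙ friezeToDelta h).map_id X)
  map_comp D D' := Subtype.ext ((shift h ⋙ friezeToDelta h).map_comp D D')

instance (h : FriezesCompose) : (friezeToDeltaLast h).IsIso where
  faithful := ⟨by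
    intro X Y D D' hD
    exact (shiftToLast h).map_injective
      (Subtype.ext ((friezeToDelta h).map_injective (congrArg Subtype.val hD)))⟩
  full := ⟨by
    rintro X Y ⟨f, hf⟩
    obtain ⟨D, rfl⟩ := (friezeToDelta h).map_surjective (X := (shift h).obj X)
      (Y := (shift h).obj Y) f
    obtain ⟨E, hE⟩ := (shiftToLast h).map_surjective (X := X) (Y := Y)
      ⟨D, Nat.succ_pos _, Nat.succ_pos _,
        (preservesLast_iff h (Nat.succ_pos _) (Nat.succ_pos _) D).1 hf⟩
    exact ⟨E, Subtype.ext (congrArg (friezeToDelta h).map (congrArg Subtype.val hE))⟩⟩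
  bijective_obj := by
    constructor
    · rintro ⟨n, a, rfl⟩ ⟨m, b, rfl⟩ hnm
      have : (2 * a + 1 + 1) / 2 = (2 * b + 1 + 1) / 2 :=
        congrArg (fun X : deltaLast.Cat => X.val.n) hnm
      obtain rfl : a = b := by omega
      rfl
    · rintro ⟨⟨_ | n⟩, hpos⟩
      · exact absurd hpos (lt_irrefl _)
      · refine ⟨⟨2 * n + 1, odd_two_mul_add_one n⟩, ?_⟩
        have key : ∀ (k : ℕ) (hk : deltaLast.obj ⟨k⟩), k = n + 1 →
            (⟨⟨k⟩, hk⟩ : deltaLast.Cat) = ⟨⟨n + 1⟩, hpos⟩ := by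
          rintro _ _ rfl
          rfl
        exact key _ _ (show (2 * n + 1 + 1) / 2 = n + 1 by omega)

end FreeAdj

theorem mainTheorem3 :
    -- the category `B` is isomorphic to the simplicial category, and, compatibly with `G`,
    -- the category `A` is isomorphic to its subcategory of last-element-preserving functions
    (∃ (T : IsoCat FreeAdj.BObj FreeAdj.Delta) (T' : IsoCat FreeAdj.AObj FreeAdj.deltaLast.Cat),
      (∀ b : FreeAdj.BObj, T.functor.obj b = ⟨b.n⟩) ∧
      T'.functor ⋙ FreeAdj.deltaLast.incl = FreeAdj.functorG ⋙ T.functor) ∧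
    -- `G` identifies `A` with the subcategory of `B` of the arrows of the form `G f`
    (∃ K : IsoCat FreeAdj.AObj FreeAdj.imageG.Cat,
      K.functor ⋙ FreeAdj.imageG.incl = FreeAdj.functorG) ∧
    -- the corresponding isomorphisms for the categories of friezes
    (∃ (h : FreeAdj.FriezesCompose) (S : IsoCat (FreeAdj.DB h) FreeAdj.Delta)
        (S' : IsoCat (FreeAdj.DA h) FreeAdj.deltaLast.Cat)
        (J : IsoCat (FreeAdj.DA h) (FreeAdj.DBLast h).Cat),
      (∀ X : FreeAdj.DB h, X.n = 2 * (S.functor.obj X).n) ∧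
      (∀ (X Y : FreeAdj.DB h) (D : X ⟶ Y) (i : Fin (S.functor.obj X).n),
        FreeAdj.Assigns (FreeAdj.FriezeCat.segs D) i (FreeAdj.Delta.fn (S.functor.map D) i)) ∧
      J.functor ⋙ (FreeAdj.DBLast h).incl = FreeAdj.shift h ∧
      S'.functor ⋙ FreeAdj.deltaLast.incl = FreeAdj.shift h ⋙ S.functor) := by
  -- The compatibility equations hold by `rfl`, since the functors on `A` and `D_A` are defined as
  -- corestrictions of the composites involved.
  refine ⟨⟨FreeAdj.evalB.asIsomorphism, FreeAdj.evalA.asIsomorphism, fun _ => rfl, rfl⟩,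
    ⟨FreeAdj.toImageG.asIsomorphism, rfl⟩,
    FreeAdj.friezesCompose, (FreeAdj.friezeToDelta _).asIsomorphism,
    (FreeAdj.friezeToDeltaLast _).asIsomorphism, (FreeAdj.shiftToLast _).asIsomorphism,
    fun X => ?_, fun X Y D i => ?_, rfl, rfl⟩
  · change X.n = 2 * (X.n / 2)
    exact (Nat.mul_div_cancel' X.prop.two_dvd).symm
  · exact FreeAdj.Frieze.assigns_upper (show FreeAdj.Frieze X.n Y.n from D) i
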